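/- For $\delta>0$, $t\in\mathbb{R}$ and $s\in\mathbb{C}\setminus\{0\}$ with $1+(t-\tfrac12)\delta>0$ put \[ w(s;\delta,t)=\frac1s\Big[\big(1+(t+\tfrac12)\delta\big)^s-\big(1+(t-\tfrac12)\delta\big)^s\Big]. \] Given $r\ge 1$ and $\boldsymbol t=(t_1,\dots,t_r)\in\mathbb{R}^r$ with $|t_j-t_k|\ge 1$ whenever $j\ne k$, write $w_j(s)=w(s;\delta,t_j)$, \[ \mathrm{Cov}_{jk}=\mathrm{Cov}_{jk}(\delta,\boldsymbol t)=\sum_{\gamma}w_j(\rho)\overline{w_k(\rho)},\qquad V_j=\mathrm{Cov}_{jj},\qquad T_{j,k}=1+\max(|t_j|,|t_k|), \] where $\rho$ runs over all nontrivial zeros of the Riemann zeta function, $\gamma=\operatorname{Im}\rho$ (of either sign), counted with multiplicity. Assume the Riemann hypothesis (RH) and the linear independence conjecture (LI): the positive ordinates of the nontrivial zeros of $\zeta$, listed with multiplicity, are linearly independent over $\mathbb{Q}$. Then there are absolute constants $C>0$ and $\delta_0>0$ such that for all $0<\delta\le\delta_0$, all $r$ and $\boldsymbol t$ as above, and all $j,k\in\{1,\dots,r\}$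 with $T=T_{j,k}\le\delta^{-1/2}\big(\log\frac1\delta\big)^{-1}$, the series defining $\mathrm{Cov}_{jk}$ converges absolutely, and \[ \Big|V_j-\delta\log\tfrac1\delta-(1-\gamma_0-\log 2\pi)\,\delta\Big|\le C\Big(T\delta\log\tfrac1\delta\Big)^2\quad\text{if } j=k, \] \[ \Big|\mathrm{Cov}_{jk}+\Delta(|t_j-t_k|)\,\delta\Big|\le C\Big(T\delta\log\tfrac1\delta\Big)^2\quad\text{if } j\ne k, \] where $\gamma_0$ is Euler's constant and \[ \Delta(t)=\tfrac12\big((t+1)\log(t+1)-2t\log t+(t-1)\log(t-1)\big)\qquad(t\ge1,\ 0\log 0=0) \] is the second order central difference of $\tfrac12t\log t$. -/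

import Mathlib

noncomputable section

namespace PrimesInShortIntervals

/-- The nontrivial zeros `ρ` of the Riemann zeta function: its zeros in the open critical strip. -/
def nontrivialZeros : Set ℂ :=
  {s : ℂ | riemannZeta s = 0 ∧ 0 < s.re ∧ s.re < 1}

/-- The nontrivial zeros listed with multiplicity: a zero `ρ` of order `m` occurs `m` times,
as `⟨ρ, 0⟩, …, ⟨ρ, m - 1⟩`. -/
abbrev ZeroIndex : Type :=
  Σ ρ : nontrivialZeros, Fin (analyticOrderNatAt riemannZeta (ρ : ℂ))

/-- The linear independence conjecture (LI): the positive ordinates `γ` of the nontrivial zeros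
of the zeta function, listed with multiplicity, are linearly independent over `ℚ`.
(In particular these zeros are simple.) -/
def LinearIndependenceConjecture : Prop :=
  LinearIndependent ℚ (fun i : {i : ZeroIndex // 0 < (i.1 : ℂ).im} => (i.1.1 : ℂ).im)

/-- `w(s; δ, t) = s⁻¹ [(1 + (t + 1/2) δ) ^ s - (1 + (t - 1/2) δ) ^ s]`. -/
def w (δ t : ℝ) (s : ℂ) : ℂ :=
  1 / s * (((1 + (t + 1 / 2) * δ : ℝ) : ℂ) ^ s - ((1 + (t - 1 / 2) * δ : ℝ) : ℂ) ^ s)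

/-- The summand `w_j(ρ) * conj (w_k(ρ))` of the covariance, as a function of the zero `ρ`. -/
def covTerm {r : ℕ} (δ : ℝ) (t : Fin r → ℝ) (j k : Fin r) (i : ZeroIndex) : ℂ :=
  w δ (t j) (i.1 : ℂ) * (starRingEnd ℂ) (w δ (t k) (i.1 : ℂ))

/-- The covariance `Cov_{jk}(δ, t) = ∑_γ w_j(ρ) * conj (w_k(ρ))`, the sum being over all
nontrivial zeros `ρ` (with ordinates `γ` of both signs), counted with multiplicity. -/
def Cov {r : ℕ} (δ : ℝ) (t : Fin r → ℝ) (j k : Fin r) : ℂ :=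
  ∑' i : ZeroIndex, covTerm δ t j k i

/-- The variance `V_j = Cov_{jj}`. -/
def V {r : ℕ} (δ : ℝ) (t : Fin r → ℝ) (j : Fin r) : ℂ :=
  Cov δ t j j

/-- `T_{j,k} = 1 + max (|t_j|, |t_k|)`. -/
def T {r : ℕ} (t : Fin r → ℝ) (j k : Fin r) : ℝ :=
  1 + max |t j| |t k|

/-- The function `f(t) = (1/2) t log t` (with value `0` at `t = 0`). -/
def halfMulLog (t : ℝ) : ℝ :=
  1 / 2 * (t * Real.log t)

/-- `Δ(t) = f(t + 1) - 2 f(t) + f(t - 1)`, the second order central difference of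
`f(t) = (1/2) t log t`. -/
def Delta (t : ℝ) : ℝ :=
  halfMulLog (t + 1) - 2 * halfMulLog t + halfMulLog (t - 1)

end PrimesInShortIntervals

end

namespace PrimesInShortIntervals

open Complex Filter Topology MeasureTheory Set

/-! ### The entire function `Ξ(s) = s (s - 1) Λ(s)` and its growth -/

/-- The entire function `s (s - 1) Λ(s)`, where `Λ` is the completed Riemann zeta function. -/
noncomputable def Xi (s : ℂ) : ℂ := s * (s - 1) * completedRiemannZeta₀ s + 1

lemma differentiable_Xi : Differentiable ℂ Xi := by
  unfold Xi
  have := differentiable_completedZeta₀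
  fun_prop

lemma Xi_zero : Xi 0 = 1 := by simp [Xi]

lemma Xi_one : Xi 1 = 1 := by simp [Xi]

lemma Xi_one_sub (s : ℂ) : Xi (1 - s) = Xi s := by
  simp only [Xi, completedRiemannZeta₀_one_sub]
  ring

lemma Xi_eq_mul_completedRiemannZeta {s : ℂ} (h0 : s ≠ 0) (h1 : s ≠ 1) :
    Xi s = s * (s - 1) * completedRiemannZeta s := by
  rw [Xi, completedRiemannZeta_eq]
  have : 1 - s ≠ 0 := sub_ne_zero.mpr h1.symm
  field_simp
  ring

lemma norm_mellin_le_of_mem_strip {f : ℝ → ℂ} {a b : ℝ} (ha : MellinConvergent f a)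
    (hb : MellinConvergent f b) :
    ∃ C, ∀ s : ℂ, a ≤ s.re → s.re ≤ b → ‖mellin f s‖ ≤ C := by
  refine ⟨∫ t in Ioi (0 : ℝ), (‖(t : ℂ) ^ ((a : ℂ) - 1) • f t‖ + ‖(t : ℂ) ^ ((b : ℂ) - 1) • f t‖),
    fun s h1 h2 => ?_⟩
  refine norm_integral_le_of_norm_le (ha.norm.add hb.norm) ?_
  refine (ae_restrict_iff' measurableSet_Ioi).mpr (Eventually.of_forall fun t ht => ?_)
  have ht : 0 < t := ht
  simp only [smul_eq_mul, norm_mul, Complex.norm_cpow_eq_rpow_re_of_pos ht, sub_re, one_re,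
    ofReal_re]
  rw [← add_mul]
  gcongr
  rcases le_total t 1 with h | h
  · have := Real.rpow_le_rpow_of_exponent_ge ht h (sub_le_sub_right h1 1)
    have := Real.rpow_nonneg ht.le (b - 1)
    linarith
  · have := Real.rpow_le_rpow_of_exponent_le h (sub_le_sub_right h2 1)
    have := Real.rpow_nonneg ht.le (a - 1)
    linarith

lemma norm_completedRiemannZeta₀_le :
    ∃ C, ∀ s : ℂ, 0 ≤ s.re → s.re ≤ 2 → ‖completedRiemannZeta₀ s‖ ≤ C := by
  have h := (HurwitzZeta.hurwitzEvenFEPair 0).isStrongFEPair_toStrongFEPair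
  obtain ⟨C, hC⟩ := norm_mellin_le_of_mem_strip (a := 0) (b := 1) (h.hasMellin _).1 (h.hasMellin _).1
  refine ⟨C / 2, fun s h1 h2 => ?_⟩
  have : completedRiemannZeta₀ s
      = mellin (HurwitzZeta.hurwitzEvenFEPair 0).f_modif (s / 2) / 2 := rfl
  rw [this, norm_div, Complex.norm_ofNat]
  have hre : (s / 2).re = s.re / 2 := by simp
  gcongr
  exact hC _ (by rw [hre]; linarith) (by rw [hre]; linarith)

lemma norm_Gamma_le_Gamma_re {s : ℂ} (hs : 0 < s.re) : ‖Gamma s‖ ≤ Real.Gamma s.re := by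
  rw [Complex.Gamma_eq_integral hs, Real.Gamma_eq_integral hs]
  refine norm_integral_le_of_norm_le (Real.GammaIntegral_convergent hs) ?_
  refine (ae_restrict_iff' measurableSet_Ioi).mpr (Eventually.of_forall fun t ht => ?_)
  have ht : 0 < t := ht
  simp only [norm_mul, Complex.norm_cpow_eq_rpow_re_of_pos ht, sub_re, one_re, norm_real,
    Real.norm_eq_abs, abs_of_pos (Real.exp_pos _)]
  exact le_rfl

lemma Gamma_le_exp {x : ℝ} (hx : 1 ≤ x) : Real.Gamma x ≤ Real.exp (2 * (x + 2) ^ (3 / 2 : ℝ)) := by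
  have hx0 : 0 < x := by linarith
  have hN := Nat.ceil_lt_add_one hx0.le
  set N := ⌈x⌉₊
  have h1 : Real.Gamma x ≤ Real.Gamma (x + 1) := by
    rw [Real.Gamma_add_one hx0.ne']
    nlinarith [Real.Gamma_pos_of_pos hx0]
  have h2 : Real.Gamma (x + 1) ≤ Real.Gamma ((N + 1 : ℕ) + 1) := by
    refine Real.Gamma_strictMonoOn_Ici.monotoneOn ?_ ?_ ?_
    · simp only [mem_Ici]; linarith
    · have : 1 ≤ (N : ℝ) := le_trans hx (Nat.le_ceil x)
      simp only [mem_Ici]; push_cast; linarith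
    · push_cast; linarith [Nat.le_ceil x]
  rw [Real.Gamma_nat_eq_factorial] at h2
  have h3 : (((N + 1).factorial : ℕ) : ℝ) ≤ ((N + 1 : ℕ) : ℝ) ^ (N + 1) := by
    exact_mod_cast Nat.factorial_le_pow (N + 1)
  have hy : 0 < x + 2 := by linarith
  have h4 : ((N + 1 : ℕ) : ℝ) ^ (N + 1) ≤ (x + 2) ^ (x + 2) := by
    rw [← Real.rpow_natCast]
    have h5 : ((N + 1 : ℕ) : ℝ) ≤ x + 2 := by push_cast; linarith
    calc ((N + 1 : ℕ) : ℝ) ^ ((N + 1 : ℕ) : ℝ) ≤ (x + 2) ^ ((N + 1 : ℕ) : ℝ) := by gcongr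
      _ ≤ _ := Real.rpow_le_rpow_of_exponent_le (by linarith) h5
  have h6 : (x + 2) ^ (x + 2) ≤ Real.exp (2 * (x + 2) ^ (3 / 2 : ℝ)) := by
    rw [Real.rpow_def_of_pos hy]
    apply Real.exp_le_exp.mpr
    have h7 := Real.log_le_rpow_div hy.le (ε := 1 / 2) (by norm_num)
    have h8 : (x + 2) ^ (3 / 2 : ℝ) = (x + 2) ^ (1 / 2 : ℝ) * (x + 2) := by
      rw [← Real.rpow_add_one hy.ne']; norm_num
    rw [h8]
    nlinarith
  linarith

lemma norm_completedRiemannZeta_le :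
    ∃ C, ∀ s : ℂ, 2 ≤ s.re →
      ‖completedRiemannZeta s‖ ≤ C * Real.exp (8 * (1 + ‖s‖) ^ (3 / 2 : ℝ)) := by
  refine ⟨∑' n : ℕ, 1 / (n : ℝ) ^ 2, fun s hs => ?_⟩
  have hsum : Summable fun n : ℕ => 1 / (n : ℝ) ^ 2 := by simp
  rw [completedZeta_eq_tsum_of_one_lt_re (by linarith), norm_mul, norm_mul, mul_comm]
  have hs2 : (s / 2).re = s.re / 2 := by simp
  have h1 : ‖∑' n : ℕ, 1 / (n : ℂ) ^ s‖ ≤ ∑' n : ℕ, 1 / (n : ℝ) ^ 2 := by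
    refine tsum_of_norm_bounded hsum.hasSum fun n => ?_
    rcases Nat.eq_zero_or_pos n with rfl | hn
    · have : s ≠ 0 := by rintro rfl; norm_num at hs
      simp [this]
    · rw [norm_div, norm_one, Complex.norm_natCast_cpow_of_pos hn]
      have : (n : ℝ) ^ 2 ≤ (n : ℝ) ^ s.re := by
        rw [← Real.rpow_natCast]
        exact Real.rpow_le_rpow_of_exponent_le (by exact_mod_cast hn) (by simpa using hs)
      gcongr
  have h2 : ‖(Real.pi : ℂ) ^ (-s / 2)‖ ≤ 1 := by
    rw [Complex.norm_cpow_eq_rpow_re_of_pos Real.pi_pos]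
    refine Real.rpow_le_one_of_one_le_of_nonpos (by linarith [Real.pi_gt_three]) ?_
    simp; linarith
  have h3 : ‖Gamma (s / 2)‖ ≤ Real.exp (8 * (1 + ‖s‖) ^ (3 / 2 : ℝ)) := by
    refine (norm_Gamma_le_Gamma_re (by rw [hs2]; linarith)).trans ?_
    refine (Gamma_le_exp (by rw [hs2]; linarith)).trans (Real.exp_le_exp.mpr ?_)
    rw [hs2]
    have h4 : s.re / 2 + 2 ≤ 2 * (1 + ‖s‖) := by
      linarith [Complex.re_le_norm s, norm_nonneg s]
    have h5 : (s.re / 2 + 2) ^ (3 / 2 : ℝ) ≤ (2 * (1 + ‖s‖)) ^ (3 / 2 : ℝ) :=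
      Real.rpow_le_rpow (by linarith) h4 (by norm_num)
    rw [Real.mul_rpow (by norm_num) (by positivity)] at h5
    have h6 : (2 : ℝ) ^ (3 / 2 : ℝ) ≤ 2 ^ (2 : ℝ) :=
      Real.rpow_le_rpow_of_exponent_le (by norm_num) (by norm_num)
    have h7 : (2 : ℝ) ^ (2 : ℝ) = 4 := by norm_num
    have h8 : 0 ≤ (1 + ‖s‖) ^ (3 / 2 : ℝ) := by positivity
    nlinarith
  have h9 : 0 ≤ ∑' n : ℕ, 1 / (n : ℝ) ^ 2 := tsum_nonneg fun n => by positivity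
  calc _ ≤ (∑' n : ℕ, 1 / (n : ℝ) ^ 2) * (1 * Real.exp (8 * (1 + ‖s‖) ^ (3 / 2 : ℝ))) := by gcongr
    _ = _ := by ring

lemma norm_Xi_le_of_re_nonneg :
    ∃ C, ∀ s : ℂ, 0 ≤ s.re → ‖Xi s‖ ≤ Real.exp (C * (1 + ‖s‖) ^ (3 / 2 : ℝ)) := by
  obtain ⟨A, hA⟩ := norm_completedRiemannZeta₀_le
  obtain ⟨B, hB⟩ := norm_completedRiemannZeta_le
  refine ⟨10 + |A| + |B|, fun s hs => ?_⟩
  set y := 1 + ‖s‖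
  have hy : 1 ≤ y := by simp [y]
  set Y := y ^ (3 / 2 : ℝ)
  have hyY : y ≤ Y := by
    simpa using Real.rpow_le_rpow_of_exponent_le hy (show (1 : ℝ) ≤ 3 / 2 by norm_num)
  have h1 : ‖s‖ ≤ y := by simp [y]
  have h2 : ‖s - 1‖ ≤ y := by
    have := norm_sub_le s 1
    simp only [norm_one] at this
    linarith
  have h3 : ‖s * (s - 1)‖ ≤ y ^ 2 := by
    rw [norm_mul, sq]; gcongr
  have h4 : y ^ 2 ≤ Real.exp (2 * Y) := by
    have : y ≤ Real.exp Y := by linarith [Real.add_one_le_exp Y]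
    calc y ^ 2 ≤ (Real.exp Y) ^ 2 := by gcongr
      _ = _ := by rw [← Real.exp_nat_mul]; norm_num
  have h5 : ∀ K : ℝ, |K| + 1 ≤ Real.exp (|K| * Y) := fun K => by
    have := Real.add_one_le_exp (|K| * Y)
    nlinarith [abs_nonneg K]
  rcases le_total s.re 2 with h | h
  · have h6 := hA s hs h
    calc ‖Xi s‖ ≤ ‖s * (s - 1) * completedRiemannZeta₀ s‖ + ‖(1 : ℂ)‖ := norm_add_le _ _
      _ ≤ y ^ 2 * |A| + 1 := by
        rw [norm_mul, norm_one]; gcongr; exact h6.trans (le_abs_self A)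
      _ ≤ y ^ 2 * (|A| + 1) := by nlinarith [abs_nonneg A]
      _ ≤ Real.exp (2 * Y) * Real.exp (|A| * Y) := by
        gcongr; exact h5 A
      _ ≤ _ := by
        rw [← Real.exp_add]; apply Real.exp_le_exp.mpr; nlinarith [abs_nonneg B]
  · have h6 := hB s h
    have h0 : s ≠ 0 := by rintro rfl; norm_num at h
    have h1' : s ≠ 1 := by rintro rfl; norm_num at h
    rw [Xi_eq_mul_completedRiemannZeta h0 h1', norm_mul]
    calc _ ≤ y ^ 2 * (|B| * Real.exp (8 * Y)) := by
          gcongr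
          exact h6.trans (by gcongr; exact le_abs_self B)
      _ ≤ Real.exp (2 * Y) * (Real.exp (|B| * Y) * Real.exp (8 * Y)) := by
          gcongr; linarith [h5 B]
      _ ≤ _ := by
        rw [← Real.exp_add, ← Real.exp_add]; apply Real.exp_le_exp.mpr; nlinarith [abs_nonneg A]

lemma norm_Xi_le : ∃ C > 0, ∀ s : ℂ, ‖Xi s‖ ≤ Real.exp (C * (1 + ‖s‖) ^ (3 / 2 : ℝ)) := by
  obtain ⟨C, hC⟩ := norm_Xi_le_of_re_nonneg
  refine ⟨4 * |C| + 1, by positivity, fun s => ?_⟩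
  have key : ∀ x : ℝ, 0 ≤ x → x ≤ 2 * (1 + ‖s‖) →
      C * x ^ (3 / 2 : ℝ) ≤ (4 * |C| + 1) * (1 + ‖s‖) ^ (3 / 2 : ℝ) := fun x hx0 hx => by
    have h5 : x ^ (3 / 2 : ℝ) ≤ (2 * (1 + ‖s‖)) ^ (3 / 2 : ℝ) :=
      Real.rpow_le_rpow hx0 hx (by norm_num)
    rw [Real.mul_rpow (by norm_num) (by positivity)] at h5
    have h6 : (2 : ℝ) ^ (3 / 2 : ℝ) ≤ 2 ^ (2 : ℝ) :=
      Real.rpow_le_rpow_of_exponent_le (by norm_num) (by norm_num)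
    have h7 : (2 : ℝ) ^ (2 : ℝ) = 4 := by norm_num
    have h8 : 0 ≤ (1 + ‖s‖) ^ (3 / 2 : ℝ) := by positivity
    calc C * x ^ (3 / 2 : ℝ) ≤ |C| * (4 * (1 + ‖s‖) ^ (3 / 2 : ℝ)) := by
          gcongr
          · exact le_abs_self C
          · nlinarith
      _ ≤ _ := by nlinarith [abs_nonneg C]
  rcases le_total 0 s.re with h | h
  · exact (hC s h).trans (Real.exp_le_exp.mpr (key _ (by positivity) (by linarith [norm_nonneg s])))
  · rw [← Xi_one_sub]
    refine (hC (1 - s) (by simp; linarith)).trans (Real.exp_le_exp.mpr (key _ (by positivity) ?_))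
    have := norm_sub_le 1 s
    simp only [norm_one] at this
    linarith [norm_nonneg s]

/-! ### Partial fractions of the logarithmic derivative of an entire function of small order -/

lemma exists_eq_pow_mul_of_differentiable {f : ℂ → ℂ} (hf : Differentiable ℂ f) {a : ℂ}
    (ha : analyticOrderAt f a ≠ ⊤) :
    ∃ g : ℂ → ℂ, Differentiable ℂ g ∧ g a ≠ 0 ∧
      ∀ z, f z = (z - a) ^ analyticOrderNatAt f a * g z := by
  obtain ⟨h, hh, hha, heq⟩ := (hf.analyticAt a).analyticOrderAt_ne_top.mp ha
  simp only [smul_eq_mul] at heq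
  set n := analyticOrderNatAt f a
  set g : ℂ → ℂ := Function.update (fun z => f z / (z - a) ^ n) a (h a) with hg
  have hne : ∀ z, z ≠ a → g z = f z / (z - a) ^ n := fun z hz => by simp [hg, hz]
  have hga : g a = h a := by simp [hg]
  refine ⟨g, fun z => ?_, by rwa [hga], fun z => ?_⟩
  · rcases eq_or_ne z a with rfl | hz
    · refine hh.differentiableAt.congr_of_eventuallyEq ?_
      filter_upwards [heq] with w hw
      rcases eq_or_ne w z with rfl | hwz
      · exact hga
      · rw [hne w hwz, hw, mul_div_cancel_left₀]
        exact pow_ne_zero _ (sub_ne_zero.mpr hwz)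
    · have : DifferentiableAt ℂ (fun z => f z / (z - a) ^ n) z :=
        (hf z).div (by fun_prop) (pow_ne_zero _ (sub_ne_zero.mpr hz))
      refine this.congr_of_eventuallyEq ?_
      filter_upwards [isOpen_ne.mem_nhds hz] with w hw using hne w hw
  · rcases eq_or_ne z a with rfl | hz
    · rw [hga]; exact heq.self_of_nhds
    · rw [hne z hz, mul_div_cancel₀]
      exact pow_ne_zero _ (sub_ne_zero.mpr hz)

lemma exists_eq_prod_mul_of_differentiable {f : ℂ → ℂ} (hf : Differentiable ℂ f)
    (hord : ∀ a, analyticOrderAt f a ≠ ⊤) (P : Finset ℂ) :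
    ∃ g : ℂ → ℂ, Differentiable ℂ g ∧ (∀ p ∈ P, g p ≠ 0) ∧
      ∀ z, f z = (∏ p ∈ P, (z - p) ^ analyticOrderNatAt f p) * g z := by
  classical
  induction P using Finset.induction_on with
  | empty => exact ⟨f, hf, by simp, by simp⟩
  | insert a P ha ih =>
    obtain ⟨g, hg, hgP, hfg⟩ := ih
    have hu : Differentiable ℂ fun z => ∏ p ∈ P, (z - p) ^ analyticOrderNatAt f p := by fun_prop
    have hua : ∏ p ∈ P, (a - p) ^ analyticOrderNatAt f p ≠ 0 :=
      Finset.prod_ne_zero_iff.mpr fun p hp =>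
        pow_ne_zero _ (sub_ne_zero.mpr fun h => ha (h ▸ hp))
    have hoa : analyticOrderAt f a = analyticOrderAt g a := by
      have h1 : f = (fun z => ∏ p ∈ P, (z - p) ^ analyticOrderNatAt f p) * g := by
        ext z; exact hfg z
      have h2 := analyticOrderAt_mul (hu.analyticAt a) (hg.analyticAt a)
      rw [← h1, (hu.analyticAt a).analyticOrderAt_eq_zero.mpr hua, zero_add] at h2
      exact h2
    obtain ⟨h, hh, hha, hgh⟩ := exists_eq_pow_mul_of_differentiable hg (hoa ▸ hord a)
    have hna : analyticOrderNatAt g a = analyticOrderNatAt f a := by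
      simp only [analyticOrderNatAt, hoa]
    refine ⟨h, hh, fun p hp => ?_, fun z => ?_⟩
    · rcases Finset.mem_insert.mp hp with rfl | hp
      · exact hha
      · intro h0
        exact hgP p hp (by rw [hgh, h0, mul_zero])
    · rw [Finset.prod_insert ha, hfg z, hgh z, hna]; ring

lemma exists_logarithm_on_ball {F : ℂ → ℂ} (hF : Differentiable ℂ F) {r : ℝ} (hr : 0 < r)
    (hF0 : F 0 = 1) (hne : ∀ z ∈ Metric.ball (0 : ℂ) r, F z ≠ 0) :
    ∃ G : ℂ → ℂ, G 0 = 0 ∧ (∀ z ∈ Metric.ball (0 : ℂ) r, HasDerivAt G (logDeriv F z) z) ∧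
      ∀ z ∈ Metric.ball (0 : ℂ) r, F z = exp (G z) := by
  have hd : DifferentiableOn ℂ (logDeriv F) (Metric.ball 0 r) := fun z hz => by
    have h1 : DifferentiableAt ℂ (deriv F) z := (hF.analyticAt z).deriv.differentiableAt
    exact (h1.div (hF z) (hne z hz)).differentiableWithinAt
  obtain ⟨G, hG0, hG⟩ := hd.isExactOn_ball.with_val_at 0 0
  refine ⟨G, hG0, hG, ?_⟩
  have hH : ∀ z ∈ Metric.ball (0 : ℂ) r, HasDerivAt (fun z => F z * exp (-G z)) 0 z := fun z hz => by
    refine ((hF z).hasDerivAt.mul (hG z hz).neg.cexp).congr_deriv ?_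
    rw [logDeriv_apply]
    have := hne z hz
    simp only [Pi.neg_apply]
    field_simp
    ring
  intro z hz
  have h1 := (convex_ball (0 : ℂ) r).norm_image_sub_le_of_norm_hasDerivWithin_le (C := 0)
    (fun z hz => (hH z hz).hasDerivWithinAt) (by simp) (Metric.mem_ball_self hr) hz
  simp only [zero_mul, norm_le_zero_iff, hG0, hF0, neg_zero, Complex.exp_zero, mul_one] at h1
  have h2 : F z * exp (-G z) = 1 := sub_eq_zero.mp h1
  rw [Complex.exp_neg] at h2
  exact (mul_inv_eq_one₀ (Complex.exp_ne_zero _)).mp h2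

lemma norm_logDeriv_sub_le {F : ℂ → ℂ} (hF : Differentiable ℂ F) {r M : ℝ} (hr : 0 < r)
    (hM : 0 < M) (hF0 : F 0 = 1) (hne : ∀ z ∈ Metric.ball (0 : ℂ) r, F z ≠ 0)
    (hle : ∀ z ∈ Metric.ball (0 : ℂ) r, ‖F z‖ ≤ Real.exp M) {z w : ℂ}
    (hz : ‖z‖ < r / 8) (hw : ‖w‖ < r / 8) :
    ‖logDeriv F w - logDeriv F z‖ ≤ 64 * M / r ^ 2 * ‖w - z‖ := by
  obtain ⟨G, hG0, hG, hFG⟩ := exists_logarithm_on_ball hF hr hF0 hne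
  have hGd : DifferentiableOn ℂ G (Metric.ball 0 r) := fun z hz =>
    (hG z hz).differentiableAt.differentiableWithinAt
  have hGre : MapsTo G (Metric.ball 0 r) {z | z.re ≤ M} := fun z hz => by
    have := hle z hz
    rw [hFG z hz, Complex.norm_exp] at this
    exact Real.exp_le_exp.mp this
  have hG1 : ∀ z, ‖z‖ ≤ r / 2 → ‖G z‖ ≤ 2 * M := fun z hz => by
    have := borelCaratheodory_zero hM hGd hGre hr (z := z) (by simp; linarith) hG0
    refine this.trans ?_
    rw [div_le_iff₀ (by linarith)]
    nlinarith
  have hL1 : ∀ z, ‖z‖ < r / 4 → ‖logDeriv F z‖ ≤ 8 * M / r := fun z hz => by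
    have hsub : ∀ w ∈ Metric.closedBall z (r / 4), ‖w‖ ≤ r / 2 := fun w hw => by
      have := norm_le_norm_add_norm_sub' w z
      rw [Metric.mem_closedBall, dist_eq_norm] at hw
      linarith
    have h1 : DiffContOnCl ℂ G (Metric.ball z (r / 4)) := by
      refine (hGd.mono ?_).diffContOnCl_ball (U := Metric.closedBall z (r / 4)) le_rfl
      intro w hw
      have := hsub w hw
      simp; linarith
    have h2 := norm_deriv_le_of_forall_mem_sphere_norm_le (by linarith : 0 < r / 4) h1
      (fun w hw => hG1 w (hsub w (Metric.sphere_subset_closedBall hw)))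
    rw [(hG z (by simp; linarith)).deriv] at h2
    refine h2.trans (le_of_eq ?_)
    field_simp; norm_num
  have hLd : DifferentiableOn ℂ (logDeriv F) (Metric.ball 0 r) := fun z hz => by
    have h1 : DifferentiableAt ℂ (deriv F) z := (hF.analyticAt z).deriv.differentiableAt
    exact (h1.div (hF z) (hne z hz)).differentiableWithinAt
  have hL2 : ∀ z ∈ Metric.ball (0 : ℂ) (r / 8), ‖deriv (logDeriv F) z‖ ≤ 64 * M / r ^ 2 :=
    fun z hz => by
    rw [mem_ball_zero_iff] at hz
    have hsub : ∀ w ∈ Metric.closedBall z (r / 8), ‖w‖ < r / 4 := fun w hw => by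
      have := norm_le_norm_add_norm_sub' w z
      rw [Metric.mem_closedBall, dist_eq_norm] at hw
      linarith
    have h1 : DiffContOnCl ℂ (logDeriv F) (Metric.ball z (r / 8)) := by
      refine (hLd.mono ?_).diffContOnCl_ball (U := Metric.closedBall z (r / 8)) le_rfl
      intro w hw
      have := hsub w hw
      simp; linarith
    have h2 := norm_deriv_le_of_forall_mem_sphere_norm_le (by linarith : 0 < r / 8) h1
      (fun w hw => hL1 w (hsub w (Metric.sphere_subset_closedBall hw)))
    refine h2.trans (le_of_eq ?_)
    field_simp; norm_num
  refine (convex_ball (0 : ℂ) (r / 8)).norm_image_sub_le_of_norm_deriv_le (fun u hu => ?_) hL2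
    (by simpa using hz) (by simpa using hw)
  refine (hLd u ?_).differentiableAt (Metric.isOpen_ball.mem_nhds ?_) <;>
  · simp only [mem_ball_zero_iff] at hu ⊢; linarith

/-- Removing finitely many zeros, the largest of modulus at most `R + 1`, does not increase
the bound of an entire function on the circle of radius `2 R + 2`. -/
lemma exists_factor_of_zeros {f : ℂ → ℂ} (hf : Differentiable ℂ f) (hf0 : f 0 = 1)
    {R B : ℝ} (hR : 0 < R) (hB : ∀ z, ‖z‖ = 2 * R + 2 → ‖f z‖ ≤ B) (P : Finset ℂ)
    (hP : ∀ p ∈ P, p ≠ 0 ∧ ‖p‖ ≤ R + 1) :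
    ∃ F : ℂ → ℂ, Differentiable ℂ F ∧ F 0 = 1 ∧ (∀ p ∈ P, F p ≠ 0) ∧
      (∀ z, ‖z‖ ≤ 2 * R + 2 → ‖F z‖ ≤ B) ∧
      ∀ z, f z = (∏ p ∈ P, (1 - z / p) ^ analyticOrderNatAt f p) * F z := by
  have hord : ∀ a, analyticOrderAt f a ≠ ⊤ := by
    have hA : AnalyticOnNhd ℂ f univ := fun z _ => hf.analyticAt z
    have h0 : analyticOrderAt f 0 ≠ ⊤ := by
      rw [(hf.analyticAt 0).analyticOrderAt_eq_zero.mpr (by simp [hf0])]; simp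
    exact fun a => hA.analyticOrderAt_ne_top_of_isPreconnected isPreconnected_univ
      (mem_univ 0) (mem_univ a) h0
  obtain ⟨g, hg, hgP, hfg⟩ := exists_eq_prod_mul_of_differentiable hf hord P
  set c := ∏ p ∈ P, (-p) ^ analyticOrderNatAt f p
  have hc : c ≠ 0 := Finset.prod_ne_zero_iff.mpr fun p hp => pow_ne_zero _ (neg_ne_zero.mpr (hP p hp).1)
  have hfF : ∀ z, f z = (∏ p ∈ P, (1 - z / p) ^ analyticOrderNatAt f p) * (c * g z) := fun z => by
    rw [hfg z, ← mul_assoc, ← Finset.prod_mul_distrib]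
    congr 1
    refine Finset.prod_congr rfl fun p hp => ?_
    rw [← mul_pow]
    congr 1
    have := (hP p hp).1
    field_simp
    ring
  have hFd : Differentiable ℂ fun z => c * g z := by fun_prop
  refine ⟨fun z => c * g z, hFd, ?_, fun p hp => mul_ne_zero hc (hgP p hp), ?_, hfF⟩
  · have := hfF 0
    simp only [hf0, zero_div, sub_zero, one_pow, Finset.prod_const_one, one_mul] at this
    exact this.symm
  · intro z hz
    have hr : 2 * R + 2 ≠ 0 := by linarith
    refine norm_le_of_forall_mem_frontier_norm_le (U := Metric.ball (0 : ℂ) (2 * R + 2))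
      Metric.isBounded_ball hFd.diffContOnCl (fun w hw => ?_)
      (by rw [closure_ball _ hr]; simpa using hz)
    rw [frontier_ball _ hr, mem_sphere_zero_iff_norm] at hw
    refine le_trans ?_ (hB w hw)
    rw [hfF w, norm_mul (∏ p ∈ P, (1 - w / p) ^ analyticOrderNatAt f p)]
    refine le_mul_of_one_le_left (norm_nonneg (c * g w)) ?_
    rw [norm_prod]
    refine Finset.one_le_prod fun p hp => ?_
    rw [norm_pow]
    refine one_le_pow₀ ?_
    have h1 := norm_sub_norm_le (w / p) (1 : ℂ)
    rw [norm_div, norm_one, norm_sub_rev] at h1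
    have h2 : 2 ≤ ‖w‖ / ‖p‖ := by
      rw [le_div_iff₀ (norm_pos_iff (a := p) |>.mpr (hP p hp).1)]
      linarith [(hP p hp).2]
    linarith

lemma logDeriv_eq_sum_add {f F : ℂ → ℂ} (hF : Differentiable ℂ F) (P : Finset ℂ)
    (hP : ∀ p ∈ P, p ≠ 0) (m : ℂ → ℕ) (hfF : ∀ z, f z = (∏ p ∈ P, (1 - z / p) ^ m p) * F z)
    {s : ℂ} (hs : s ∉ P) (hfs : f s ≠ 0) :
    logDeriv f s = ∑ p ∈ P, (m p : ℂ) * (1 / (s - p)) + logDeriv F s := by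
  have h1 : f = fun z => (∏ p ∈ P, (1 - z / p) ^ m p) * F z := funext hfF
  have hne : ∀ p ∈ P, 1 - s / p ≠ 0 := fun p hp h => by
    rw [sub_eq_zero, eq_comm, div_eq_one_iff_eq (hP p hp)] at h
    exact hs (h ▸ hp)
  have h2 : ∏ p ∈ P, (1 - s / p) ^ m p ≠ 0 :=
    Finset.prod_ne_zero_iff.mpr fun p hp => pow_ne_zero _ (hne p hp)
  have h3 : F s ≠ 0 := fun h => hfs (by rw [hfF, h, mul_zero])
  rw [h1, logDeriv_mul s h2 h3 (by fun_prop) (hF s)]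
  congr 1
  rw [logDeriv_prod (f := fun p z => (1 - z / p) ^ m p) (fun p hp => pow_ne_zero _ (hne p hp)) (fun p hp => by fun_prop)]
  refine Finset.sum_congr rfl fun p hp => ?_
  have hp0 := hP p hp
  rw [logDeriv_fun_pow (by fun_prop), logDeriv_apply]
  congr 1
  have h4 : HasDerivAt (fun z : ℂ => 1 - z / p) (-(1 / p)) s :=
    ((hasDerivAt_id s).div_const p).const_sub 1
  rw [h4.deriv]
  have h5 := hne p hp
  have h6 : s - p ≠ 0 := sub_ne_zero.mpr fun h => hs (h ▸ hp)
  have h7 : 1 - s / p = -(s - p) / p := by field_simp; ring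
  rw [h7]
  field_simp

lemma analyticOrderNatAt_one_sub {f : ℂ → ℂ} (hsymm : ∀ s, f (1 - s) = f s) (p : ℂ) :
    analyticOrderNatAt f (1 - p) = analyticOrderNatAt f p := by
  have hd : HasDerivAt (fun z : ℂ => 1 - z) (-1) p := (hasDerivAt_id p).const_sub 1
  have h1 : AnalyticAt ℂ (fun z : ℂ => 1 - z) p := by fun_prop
  have h2 := analyticOrderAt_comp_of_deriv_ne_zero h1 (by rw [hd.deriv]; simp) (f := f)
  have h3 : f ∘ (fun z : ℂ => 1 - z) = f := funext hsymm
  rw [h3] at h2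
  simp only [analyticOrderNatAt, h2]

lemma logDeriv_one_sub {f : ℂ → ℂ} (hf : Differentiable ℂ f)
    (hsymm : ∀ s, f (1 - s) = f s) (s : ℂ) : logDeriv f (1 - s) = -logDeriv f s := by
  have hd : HasDerivAt (fun z : ℂ => 1 - z) (-1) s := (hasDerivAt_id s).const_sub 1
  have h1 := ((hf (1 - s)).hasDerivAt.comp s hd).deriv
  have h3 : f ∘ (fun z : ℂ => 1 - z) = f := funext hsymm
  rw [h3] at h1
  rw [logDeriv_apply, logDeriv_apply, h1, hsymm]
  ring

/-- The symmetric partial fraction expansion of `f' / f` for an entire function of order less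
than two which is invariant under `s ↦ 1 - s`. -/
theorem tendsto_sum_zeros_logDeriv {f : ℂ → ℂ} (hf : Differentiable ℂ f) (hf0 : f 0 = 1)
    (hsymm : ∀ s, f (1 - s) = f s) {C : ℝ} (hC : 0 < C)
    (hgrowth : ∀ s, ‖f s‖ ≤ Real.exp (C * (1 + ‖s‖) ^ (3 / 2 : ℝ)))
    (P : ℕ → Finset ℂ) (hP : ∀ N z, z ∈ P N ↔ f z = 0 ∧ ‖z - 1 / 2‖ ≤ N) {s : ℂ} (hs : f s ≠ 0) :
    Tendsto (fun N => ∑ p ∈ P N, (analyticOrderNatAt f p : ℂ) * (1 / (s - p))) atTop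
      (𝓝 (logDeriv f s)) := by
  have hbound : ∀ N : ℕ, 1 ≤ N → 16 * ‖s‖ < N → 16 * ‖1 - s‖ < N →
      ‖logDeriv f s - ∑ p ∈ P N, (analyticOrderNatAt f p : ℂ) * (1 / (s - p))‖
        ≤ 128 * C * 5 ^ (3 / 2 : ℝ) * ‖s - (1 - s)‖ * ((N : ℝ) ^ (1 / 2 : ℝ))⁻¹ := by
    intro N hN hN1 hN2
    have hN' : (1 : ℝ) ≤ N := by exact_mod_cast hN
    have hN0 : (0 : ℝ) < N := by linarith
    set M := C * (1 + (2 * N + 2)) ^ (3 / 2 : ℝ) with hM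
    have hMpos : 0 < M := by positivity
    have hPN : ∀ p ∈ P N, p ≠ 0 ∧ ‖p‖ ≤ N + 1 := fun p hp => by
      obtain ⟨h1, h2⟩ := (hP N p).mp hp
      refine ⟨by rintro rfl; simp [hf0] at h1, ?_⟩
      have := norm_le_norm_add_norm_sub' p (1 / 2)
      have h3 : ‖(1 / 2 : ℂ)‖ = 1 / 2 := by norm_num
      linarith
    obtain ⟨F, hF, hF0, hFP, hFB, hfF⟩ := exists_factor_of_zeros hf hf0 hN0
      (B := Real.exp M) (fun z hz => by rw [hM, ← hz]; exact hgrowth z) (P N) hPN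
    have hFne : ∀ z ∈ Metric.ball (0 : ℂ) ((N : ℝ) / 2), F z ≠ 0 := fun z hz h0 => by
      rw [mem_ball_zero_iff] at hz
      refine hFP z ((hP N z).mpr ⟨by rw [hfF, h0, mul_zero], ?_⟩) h0
      have := norm_sub_le z (1 / 2)
      have h3 : ‖(1 / 2 : ℂ)‖ = 1 / 2 := by norm_num
      linarith
    have hkey := norm_logDeriv_sub_le hF (r := (N : ℝ) / 2) (by linarith) hMpos hF0 hFne
      (fun z hz => hFB z (by rw [mem_ball_zero_iff] at hz; linarith))
      (z := 1 - s) (w := s) (by linarith) (by linarith)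
    have hs' : f (1 - s) ≠ 0 := by rwa [hsymm]
    have hsP : s ∉ P N := fun h => hs ((hP N s).mp h).1
    have hsP' : 1 - s ∉ P N := fun h => hs' ((hP N _).mp h).1
    have e1 := logDeriv_eq_sum_add hF (P N) (fun p hp => (hPN p hp).1) _ hfF hsP hs
    have e2 := logDeriv_eq_sum_add hF (P N) (fun p hp => (hPN p hp).1) _ hfF hsP' hs'
    have e3 : ∑ p ∈ P N, (analyticOrderNatAt f p : ℂ) * (1 / (1 - s - p))
        = -∑ p ∈ P N, (analyticOrderNatAt f p : ℂ) * (1 / (s - p)) := by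
      rw [← Finset.sum_neg_distrib]
      have hmem : ∀ p ∈ P N, 1 - p ∈ P N := fun p hp => by
        obtain ⟨h1, h2⟩ := (hP N p).mp hp
        refine (hP N _).mpr ⟨by rwa [hsymm], ?_⟩
        rw [← norm_neg]
        rwa [show -(1 - p - 1 / 2) = p - 1 / 2 by ring]
      refine Finset.sum_bij' (fun p _ => 1 - p) (fun p _ => 1 - p) hmem hmem (by simp) (by simp)
        fun p hp => ?_
      rw [analyticOrderNatAt_one_sub hsymm, ← mul_neg]
      congr 1
      have h1 : 1 - s - p ≠ 0 := fun h => hsP' (by rwa [sub_eq_zero.mp h])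
      rw [show s - (1 - p) = -(1 - s - p) by ring, div_neg, neg_neg]
    rw [logDeriv_one_sub hf hsymm, e3] at e2
    have e4 : logDeriv f s - ∑ p ∈ P N, (analyticOrderNatAt f p : ℂ) * (1 / (s - p))
        = (logDeriv F s - logDeriv F (1 - s)) / 2 := by
      linear_combination (1 / 2 : ℂ) * e1 - (1 / 2 : ℂ) * e2
    rw [e4, norm_div, Complex.norm_ofNat, div_le_iff₀ (by norm_num)]
    refine hkey.trans ?_
    have h5 : (1 + (2 * (N : ℝ) + 2)) ^ (3 / 2 : ℝ) ≤ 5 ^ (3 / 2 : ℝ) * (N : ℝ) ^ (3 / 2 : ℝ) := by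
      rw [← Real.mul_rpow (by norm_num) hN0.le]
      exact Real.rpow_le_rpow (by positivity) (by linarith) (by norm_num)
    have h6 : (N : ℝ) ^ (3 / 2 : ℝ) / (N : ℝ) ^ 2 = ((N : ℝ) ^ (1 / 2 : ℝ))⁻¹ := by
      rw [← Real.rpow_natCast, ← Real.rpow_sub hN0, ← Real.rpow_neg hN0.le]
      norm_num
    rw [← h6]
    calc 64 * M / ((N : ℝ) / 2) ^ 2 * ‖s - (1 - s)‖
        = 256 * C * ‖s - (1 - s)‖ * ((1 + (2 * (N : ℝ) + 2)) ^ (3 / 2 : ℝ) / (N : ℝ) ^ 2) := by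
          rw [hM]; field_simp; ring
      _ ≤ 256 * C * ‖s - (1 - s)‖ * (5 ^ (3 / 2 : ℝ) * (N : ℝ) ^ (3 / 2 : ℝ) / (N : ℝ) ^ 2) := by
          gcongr
      _ = _ := by ring
  rw [tendsto_iff_norm_sub_tendsto_zero]
  have hlim : Tendsto (fun N : ℕ => 128 * C * 5 ^ (3 / 2 : ℝ) * ‖s - (1 - s)‖ *
      ((N : ℝ) ^ (1 / 2 : ℝ))⁻¹) atTop (𝓝 0) := by
    have := (tendsto_rpow_atTop (show (0 : ℝ) < 1 / 2 by norm_num)).comp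
      (tendsto_natCast_atTop_atTop (R := ℝ))
    simpa using this.inv_tendsto_atTop.const_mul (128 * C * 5 ^ (3 / 2 : ℝ) * ‖s - (1 - s)‖)
  refine squeeze_zero' (Eventually.of_forall fun _ => norm_nonneg _) ?_ hlim
  have hcast := tendsto_natCast_atTop_atTop (R := ℝ)
  filter_upwards [eventually_ge_atTop 1, hcast.eventually_gt_atTop (16 * ‖s‖),
    hcast.eventually_gt_atTop (16 * ‖1 - s‖)] with N h1 h2 h3
  rw [norm_sub_rev]
  exact hbound N h1 h2 h3

/-! ### Sums over the nontrivial zeros -/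

lemma riemannZeta_eq_Xi_mul {s : ℂ} (h0 : s ≠ 0) (h1 : s ≠ 1) :
    riemannZeta s = Xi s * ((Gammaℝ s)⁻¹ / (s * (s - 1))) := by
  rw [riemannZeta_def_of_ne_zero h0, Xi_eq_mul_completedRiemannZeta h0 h1]
  have : s - 1 ≠ 0 := sub_ne_zero.mpr h1
  field_simp

lemma Xi_ne_zero_of_one_le_re {s : ℂ} (hs : 1 ≤ s.re) : Xi s ≠ 0 := by
  rcases eq_or_ne s 1 with rfl | h1
  · simp [Xi_one]
  · have h0 : s ≠ 0 := by rintro rfl; norm_num at hs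
    intro h
    have := riemannZeta_ne_zero_of_one_le_re hs
    rw [riemannZeta_eq_Xi_mul h0 h1, h, zero_mul] at this
    exact this rfl

lemma Xi_eq_zero_iff {s : ℂ} : Xi s = 0 ↔ s ∈ nontrivialZeros := by
  constructor
  · intro h
    have h2 : s.re < 1 := by
      by_contra! h'
      exact Xi_ne_zero_of_one_le_re h' h
    have h3 : 0 < s.re := by
      by_contra! h'
      exact Xi_ne_zero_of_one_le_re (s := 1 - s) (by simpa using h') (by rwa [Xi_one_sub])
    have h0 : s ≠ 0 := by rintro rfl; norm_num at h3
    have h1 : s ≠ 1 := by rintro rfl; norm_num at h2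
    exact ⟨by rw [riemannZeta_eq_Xi_mul h0 h1, h, zero_mul], h3, h2⟩
  · rintro ⟨h, h3, h2⟩
    have h0 : s ≠ 0 := by rintro rfl; norm_num at h3
    have h1 : s ≠ 1 := by rintro rfl; norm_num at h2
    have h4 : s - 1 ≠ 0 := sub_ne_zero.mpr h1
    rw [riemannZeta_eq_Xi_mul h0 h1] at h
    refine (mul_eq_zero.mp h).resolve_right ?_
    have := Gammaℝ_ne_zero_of_re_pos h3
    positivity

lemma analyticOrderNatAt_riemannZeta {s : ℂ} (hs : s ∈ nontrivialZeros) :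
    analyticOrderNatAt riemannZeta s = analyticOrderNatAt Xi s := by
  obtain ⟨h, h3, h2⟩ := hs
  have h0 : s ≠ 0 := by rintro rfl; norm_num at h3
  have h1 : s ≠ 1 := by rintro rfl; norm_num at h2
  have h4 : s - 1 ≠ 0 := sub_ne_zero.mpr h1
  set u : ℂ → ℂ := fun s => (Gammaℝ s)⁻¹ / (s * (s - 1)) with hu
  have hua : AnalyticAt ℂ u s := by
    have h5 : AnalyticAt ℂ (fun s => (Gammaℝ s)⁻¹) s := differentiable_Gammaℝ_inv.analyticAt s
    exact h5.div (by fun_prop) (mul_ne_zero h0 h4)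
  have hus : u s ≠ 0 := by
    have := Gammaℝ_ne_zero_of_re_pos h3
    simp only [hu]
    positivity
  have heq : riemannZeta =ᶠ[𝓝 s] Xi * u := by
    filter_upwards [isOpen_ne.mem_nhds h0, isOpen_ne.mem_nhds h1] with w hw0 hw1
    exact riemannZeta_eq_Xi_mul hw0 hw1
  have h6 : analyticOrderAt riemannZeta s = analyticOrderAt Xi s := by
    rw [analyticOrderAt_congr heq, analyticOrderAt_mul (differentiable_Xi.analyticAt s) hua,
      hua.analyticOrderAt_eq_zero.mpr hus, add_zero]
  simp only [analyticOrderNatAt, h6]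

lemma finite_zeros_Xi (N : ℕ) : {z : ℂ | Xi z = 0 ∧ ‖z - 1 / 2‖ ≤ N}.Finite := by
  refine ((isCompact_closedBall (1 / 2 : ℂ) N).inter_riemannZetaZeros_finite).subset ?_
  rintro z ⟨h1, h2⟩
  exact ⟨by simpa [dist_eq_norm] using h2, (Xi_eq_zero_iff.mp h1).1⟩

/-- The zeros of `Xi` at distance at most `N` from `1 / 2`. -/
noncomputable def zerosUpTo (N : ℕ) : Finset ℂ := (finite_zeros_Xi N).toFinset

lemma mem_zerosUpTo {N : ℕ} {z : ℂ} : z ∈ zerosUpTo N ↔ Xi z = 0 ∧ ‖z - 1 / 2‖ ≤ N := by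
  simp [zerosUpTo]

open Classical in
/-- The nontrivial zeros at distance at most `N` from `1 / 2`, listed with multiplicity. -/
noncomputable def indexUpTo (N : ℕ) : Finset ZeroIndex :=
  ((zerosUpTo N).subtype (· ∈ nontrivialZeros)).sigma fun _ => Finset.univ

lemma mem_indexUpTo {N : ℕ} {i : ZeroIndex} : i ∈ indexUpTo N ↔ ‖(i.1 : ℂ) - 1 / 2‖ ≤ N := by
  simp only [indexUpTo, Finset.mem_sigma, Finset.mem_subtype, mem_zerosUpTo, Finset.mem_univ,
    and_true, and_iff_right_iff_imp]
  exact fun _ => Xi_eq_zero_iff.mpr i.1.2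

lemma sum_indexUpTo (N : ℕ) (F : ℂ → ℂ) :
    ∑ i ∈ indexUpTo N, F (i.1 : ℂ) = ∑ p ∈ zerosUpTo N, (analyticOrderNatAt Xi p : ℂ) * F p := by
  classical
  rw [indexUpTo, Finset.sum_sigma]
  simp only [Finset.sum_const, Finset.card_univ, Fintype.card_fin, nsmul_eq_mul]
  rw [← Finset.sum_subtype_of_mem (p := (· ∈ nontrivialZeros))
    (fun p => (analyticOrderNatAt Xi p : ℂ) * F p)
    (fun p hp => Xi_eq_zero_iff.mp (mem_zerosUpTo.mp hp).1)]
  exact Finset.sum_congr rfl fun p _ => by rw [analyticOrderNatAt_riemannZeta p.2]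

lemma tendsto_indexUpTo : Tendsto indexUpTo atTop atTop := by
  refine tendsto_atTop_finset_of_monotone (fun M N hMN i hi => ?_) fun i => ?_
  · rw [mem_indexUpTo] at hi ⊢
    exact hi.trans (by exact_mod_cast hMN)
  · obtain ⟨N, hN⟩ := exists_nat_ge ‖(i.1 : ℂ) - 1 / 2‖
    exact ⟨N, mem_indexUpTo.mpr hN⟩

lemma tendsto_sum_indexUpTo_logDeriv {s : ℂ} (hs : Xi s ≠ 0) :
    Tendsto (fun N => ∑ i ∈ indexUpTo N, 1 / (s - (i.1 : ℂ))) atTop (𝓝 (logDeriv Xi s)) := by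
  obtain ⟨C, hC, hgrowth⟩ := norm_Xi_le
  have := tendsto_sum_zeros_logDeriv differentiable_Xi Xi_zero Xi_one_sub hC hgrowth zerosUpTo
    (fun N z => mem_zerosUpTo) hs
  exact this.congr fun N => (sum_indexUpTo N fun p => 1 / (s - p)).symm

/-- The involution `ρ ↦ 1 - ρ` of the nontrivial zeros. -/
def reflectZeros : nontrivialZeros ≃ nontrivialZeros where
  toFun ρ := ⟨1 - ρ, Xi_eq_zero_iff.mp (by rw [Xi_one_sub]; exact Xi_eq_zero_iff.mpr ρ.2)⟩
  invFun ρ := ⟨1 - ρ, Xi_eq_zero_iff.mp (by rw [Xi_one_sub]; exact Xi_eq_zero_iff.mpr ρ.2)⟩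
  left_inv ρ := by ext; simp
  right_inv ρ := by ext; simp

/-- The involution `ρ ↦ 1 - ρ` of the nontrivial zeros listed with multiplicity. -/
noncomputable def reflect : ZeroIndex ≃ ZeroIndex :=
  Equiv.sigmaCongr reflectZeros fun ρ => finCongr (by
    rw [analyticOrderNatAt_riemannZeta ρ.2, analyticOrderNatAt_riemannZeta (reflectZeros ρ).2]
    exact (analyticOrderNatAt_one_sub Xi_one_sub _).symm)

@[simp] lemma coe_reflect (i : ZeroIndex) : ((reflect i).1 : ℂ) = 1 - (i.1 : ℂ) := rfl

lemma sum_indexUpTo_reflect (N : ℕ) (F : ℂ → ℂ) :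
    ∑ i ∈ indexUpTo N, F (1 - (i.1 : ℂ)) = ∑ i ∈ indexUpTo N, F (i.1 : ℂ) := by
  refine Finset.sum_equiv reflect (fun i => ?_) fun i _ => by simp
  rw [mem_indexUpTo, mem_indexUpTo, coe_reflect, ← norm_neg]
  ring_nf

lemma ZeroIndex.ne_zero (i : ZeroIndex) : (i.1 : ℂ) ≠ 0 := fun h => by
  have := i.1.2.2.1
  simp [h] at this

lemma ZeroIndex.one_sub_ne_zero (i : ZeroIndex) : 1 - (i.1 : ℂ) ≠ 0 := fun h => by
  have := i.1.2.2.2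
  simp [← sub_eq_zero.mp h] at this

section RH

lemma re_eq_half (hRH : RiemannHypothesis) (i : ZeroIndex) : (i.1 : ℂ).re = 1 / 2 := by
  obtain ⟨h, h3, h2⟩ := i.1.2
  refine hRH _ h ?_ (fun h1 => by simp [h1] at h2)
  rintro ⟨n, hn⟩
  rw [hn] at h3
  norm_num at h3
  linarith

lemma conj_eq_one_sub (hRH : RiemannHypothesis) (i : ZeroIndex) :
    (starRingEnd ℂ) (i.1 : ℂ) = 1 - (i.1 : ℂ) := by
  apply Complex.ext
  · simp [re_eq_half hRH i]; norm_num
  · simp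

lemma norm_mul_one_sub (hRH : RiemannHypothesis) (i : ZeroIndex) :
    ‖(i.1 : ℂ) * (1 - (i.1 : ℂ))‖ = 1 / 4 + (i.1 : ℂ).im ^ 2 := by
  rw [← conj_eq_one_sub hRH, Complex.mul_conj, Complex.norm_real, Complex.normSq_apply,
    re_eq_half hRH i, Real.norm_eq_abs, abs_of_nonneg]
  · ring
  · nlinarith [sq_nonneg (i.1 : ℂ).im]

lemma re_one_div_two_sub (hRH : RiemannHypothesis) (i : ZeroIndex) :
    (1 / (2 - (i.1 : ℂ))).re = 3 / 2 / (9 / 4 + (i.1 : ℂ).im ^ 2) := by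
  rw [one_div, Complex.inv_re, Complex.normSq_apply]
  simp [re_eq_half hRH i]
  ring

lemma summable_re_one_div_two_sub (hRH : RiemannHypothesis) :
    Summable fun i : ZeroIndex => 3 / 2 / (9 / 4 + (i.1 : ℂ).im ^ 2) := by
  have h1 := tendsto_sum_indexUpTo_logDeriv (s := 2) (Xi_ne_zero_of_one_le_re (by norm_num))
  have h2 := (Complex.continuous_re.tendsto _).comp h1
  have h3 : (Complex.re ∘ fun N => ∑ i ∈ indexUpTo N, 1 / (2 - (i.1 : ℂ)))
      = fun N => ∑ i ∈ indexUpTo N, 3 / 2 / (9 / 4 + (i.1 : ℂ).im ^ 2) := by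
    ext N
    simp only [Function.comp, Complex.re_sum, re_one_div_two_sub hRH]
  rw [h3] at h2
  obtain ⟨B, hB⟩ := h2.bddAbove_range
  refine summable_of_sum_le (c := B) (fun i => by positivity) fun u => ?_
  obtain ⟨N, hN⟩ := (tendsto_indexUpTo.eventually_ge_atTop u).exists
  exact (Finset.sum_le_sum_of_subset_of_nonneg hN fun i _ _ => by positivity).trans
    (hB (mem_range_self N))

lemma summable_inv_quarter_add (hRH : RiemannHypothesis) :
    Summable fun i : ZeroIndex => 1 / (1 / 4 + (i.1 : ℂ).im ^ 2) := by
  refine Summable.of_nonneg_of_le (fun i => by positivity) (fun i => ?_)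
    ((summable_re_one_div_two_sub hRH).mul_left 6)
  rw [mul_div, div_le_div_iff₀ (by positivity) (by positivity)]
  nlinarith [sq_nonneg (i.1 : ℂ).im]

lemma countable_zeroIndex (hRH : RiemannHypothesis) : Countable ZeroIndex := by
  have h := (summable_inv_quarter_add hRH).countable_support
  have h2 : Function.support (fun i : ZeroIndex => 1 / (1 / 4 + (i.1 : ℂ).im ^ 2)) = univ := by
    ext i
    simp only [Function.mem_support, mem_univ, iff_true]
    positivity
  rw [h2] at h
  exact Set.countable_univ_iff.mp h

lemma summable_one_div_mul_one_sub (hRH : RiemannHypothesis) :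
    Summable fun i : ZeroIndex => 1 / ((i.1 : ℂ) * (1 - (i.1 : ℂ))) := by
  refine Summable.of_norm ((summable_inv_quarter_add hRH).congr fun i => ?_)
  rw [norm_div, norm_one, norm_mul_one_sub hRH]

/-- Half the sum of `1 / (ρ (1 - ρ))` over the nontrivial zeros. -/
noncomputable def zeroConst : ℂ := 1 / 2 * ∑' i : ZeroIndex, 1 / ((i.1 : ℂ) * (1 - (i.1 : ℂ)))

lemma norm_sub_zero_ge (hRH : RiemannHypothesis) {s : ℂ} (hs : 1 < s.re) (i : ZeroIndex) :
    1 / 2 ≤ ‖s - (i.1 : ℂ)‖ := by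
  have := Complex.re_le_norm (s - (i.1 : ℂ))
  rw [sub_re, re_eq_half hRH] at this
  linarith

lemma summable_zeros_cauchy (hRH : RiemannHypothesis) {s : ℂ} (hs : 1 < s.re) :
    Summable fun i : ZeroIndex => 1 / ((i.1 : ℂ) * (1 - (i.1 : ℂ))) * (1 / (s - (i.1 : ℂ))) := by
  refine Summable.of_norm_bounded ((summable_inv_quarter_add hRH).mul_right 2) fun i => ?_
  rw [norm_mul, norm_div, norm_one, norm_mul_one_sub hRH, norm_div, norm_one]
  gcongr
  have := norm_sub_zero_ge hRH hs i
  rw [div_le_iff₀ (by linarith)]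
  linarith

lemma tsum_zeros_cauchy (hRH : RiemannHypothesis) {s : ℂ} (hs : 1 < s.re) :
    s * (1 - s) * ∑' i : ZeroIndex, 1 / ((i.1 : ℂ) * (1 - (i.1 : ℂ))) * (1 / (s - (i.1 : ℂ)))
      = logDeriv Xi s + (1 - 2 * s) * zeroConst := by
  have h1 := (((summable_zeros_cauchy hRH hs).hasSum.comp tendsto_indexUpTo).const_mul (s * (1 - s)))
  have h2 := (tendsto_sum_indexUpTo_logDeriv (Xi_ne_zero_of_one_le_re hs.le)).add
    (((summable_one_div_mul_one_sub hRH).hasSum.comp tendsto_indexUpTo).const_mul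
      ((1 - 2 * s) * (1 / 2)))
  have h3 := tendsto_nhds_unique h1 (h2.congr fun N => ?_)
  · rw [h3, zeroConst]; ring
  · simp only [Function.comp]
    have e1 := sum_indexUpTo_reflect N fun p => 1 / p
    have e2 : ∑ i ∈ indexUpTo N, 1 / ((i.1 : ℂ) * (1 - (i.1 : ℂ)))
        = 2 * ∑ i ∈ indexUpTo N, 1 / (i.1 : ℂ) := by
      rw [two_mul]
      nth_rw 2 [← e1]
      rw [← Finset.sum_add_distrib]
      refine Finset.sum_congr rfl fun i _ => ?_
      have := i.ne_zero
      have := i.one_sub_ne_zero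
      field_simp
      ring
    have e3 : s * (1 - s) * ∑ i ∈ indexUpTo N,
          1 / ((i.1 : ℂ) * (1 - (i.1 : ℂ))) * (1 / (s - (i.1 : ℂ)))
        = ∑ i ∈ indexUpTo N, 1 / (s - (i.1 : ℂ)) + (1 - s) * ∑ i ∈ indexUpTo N, 1 / (i.1 : ℂ)
          - s * ∑ i ∈ indexUpTo N, 1 / (1 - (i.1 : ℂ)) := by
      simp only [Finset.mul_sum]
      rw [← Finset.sum_add_distrib, ← Finset.sum_sub_distrib]
      refine Finset.sum_congr rfl fun i _ => ?_
      have := i.ne_zero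
      have := i.one_sub_ne_zero
      have h4 : s - (i.1 : ℂ) ≠ 0 := fun h => by
        have := norm_sub_zero_ge hRH hs i
        rw [h, norm_zero] at this
        linarith
      field_simp
      ring
    rw [e3, e1, e2]
    ring

end RH

/-! ### The partial fraction expansion of the digamma function -/

lemma half_le_norm_natCast_add {z : ℂ} (hz : -(1 / 2) < z.re) (k : ℕ) :
    ((k : ℝ) + 1) / 2 ≤ ‖(k : ℂ) + 1 + z‖ := by
  have := Complex.re_le_norm ((k : ℂ) + 1 + z)
  simp at this
  have : (0 : ℝ) ≤ k := k.cast_nonneg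
  linarith

lemma hasDerivAt_div_sub_log {z : ℂ} (hz : -(1 / 2) < z.re) (k : ℕ) :
    HasDerivAt (fun z : ℂ => z / ((k : ℂ) + 1) - log (1 + z / ((k : ℂ) + 1)))
      (1 / ((k : ℂ) + 1) - 1 / ((k : ℂ) + 1 + z)) z := by
  have hk : (k : ℂ) + 1 ≠ 0 := by exact_mod_cast Nat.succ_ne_zero k
  have hne : (k : ℂ) + 1 + z ≠ 0 :=
    norm_pos_iff.mp (lt_of_lt_of_le (by positivity) (half_le_norm_natCast_add hz k))
  have h1 : HasDerivAt (fun z : ℂ => z / ((k : ℂ) + 1)) (1 / ((k : ℂ) + 1)) z :=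
    (hasDerivAt_id z).div_const _
  have h2 : 1 + z / ((k : ℂ) + 1) ∈ slitPlane := by
    left
    have h3 : z / ((k : ℂ) + 1) = z / ((k + 1 : ℝ) : ℂ) := by push_cast; rfl
    rw [h3, add_re, one_re, Complex.div_ofReal_re]
    have : (0 : ℝ) ≤ k := k.cast_nonneg
    have h5 : -1 < z.re / (k + 1) := by
      rw [lt_div_iff₀ (by positivity)]; linarith
    linarith
  refine (h1.sub ((h1.const_add 1).clog h2)).congr_deriv ?_
  have h6 : 1 + z / ((k : ℂ) + 1) = ((k : ℂ) + 1 + z) / ((k : ℂ) + 1) := by field_simp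
  rw [h6]
  field_simp

lemma norm_one_div_sub_one_div_add_le {z : ℂ} (hz : -(1 / 2) < z.re) (k : ℕ) :
    ‖1 / ((k : ℂ) + 1) - 1 / ((k : ℂ) + 1 + z)‖ ≤ 2 * ‖z‖ * (1 / ((k : ℝ) + 1) ^ 2) := by
  have hk' : ‖(k : ℂ) + 1‖ = k + 1 := by exact_mod_cast Complex.norm_natCast (k + 1)
  have hk : (k : ℂ) + 1 ≠ 0 := by exact_mod_cast Nat.succ_ne_zero k
  have h2 := half_le_norm_natCast_add hz k
  have hne : (k : ℂ) + 1 + z ≠ 0 := norm_pos_iff.mp (lt_of_lt_of_le (by positivity) h2)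
  have h4 : 1 / ((k : ℂ) + 1) - 1 / ((k : ℂ) + 1 + z)
      = z / (((k : ℂ) + 1) * ((k : ℂ) + 1 + z)) := by
    field_simp; ring
  rw [h4, norm_div, norm_mul, hk']
  calc ‖z‖ / (((k : ℝ) + 1) * ‖(k : ℂ) + 1 + z‖)
      ≤ ‖z‖ / (((k : ℝ) + 1) * (((k : ℝ) + 1) / 2)) := by gcongr
    _ = _ := by field_simp

lemma summable_const_mul_one_div_succ_sq (c : ℝ) :
    Summable fun k : ℕ => c * (1 / ((k : ℝ) + 1) ^ 2) := by
  have := (summable_nat_add_iff 1).mpr (Real.summable_one_div_nat_pow.mpr one_lt_two)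
  exact (this.congr fun k => by push_cast; rfl).mul_left _

lemma hasDerivAt_tsum_sub_log {s : ℂ} (hs : 0 < s.re) :
    (Summable fun k : ℕ => s / ((k : ℂ) + 1) - log (1 + s / ((k : ℂ) + 1))) ∧
    HasDerivAt (fun z : ℂ => ∑' k : ℕ, (z / ((k : ℂ) + 1) - log (1 + z / ((k : ℂ) + 1))))
      (∑' k : ℕ, (1 / ((k : ℂ) + 1) - 1 / ((k : ℂ) + 1 + s))) s := by
  obtain ⟨t, ht⟩ : ∃ t : Set ℂ, t = Metric.ball 0 (‖s‖ + 1) ∩ {z | -(1 / 2) < z.re} := ⟨_, rfl⟩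
  have ho : IsOpen t := by
    rw [ht]; exact Metric.isOpen_ball.inter (isOpen_lt continuous_const continuous_re)
  have hc : IsPreconnected t := by
    rw [ht]; exact ((convex_ball (0 : ℂ) _).inter (convex_halfSpace_re_gt _)).isPreconnected
  have ht' : ∀ z ∈ t, ‖z‖ < ‖s‖ + 1 ∧ -(1 / 2) < z.re := fun z hz => by simpa [ht] using hz
  have h0 : (0 : ℂ) ∈ t := by
    have : 0 < ‖s‖ + 1 := by positivity
    simpa [ht] using this
  have hst : s ∈ t := by
    have : -(1 / 2) < s.re := by linarith
    simpa [ht] using this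
  have hb : ∀ (k : ℕ), ∀ z ∈ t, ‖1 / ((k : ℂ) + 1) - 1 / ((k : ℂ) + 1 + z)‖
      ≤ 2 * (‖s‖ + 1) * (1 / ((k : ℝ) + 1) ^ 2) := fun k z hz =>
    (norm_one_div_sub_one_div_add_le (ht' z hz).2 k).trans (by gcongr; exact (ht' z hz).1.le)
  have hd := fun (k : ℕ) (z : ℂ) (hz : z ∈ t) => hasDerivAt_div_sub_log (ht' z hz).2 k
  have hs0 : Summable fun k : ℕ => (0 : ℂ) / ((k : ℂ) + 1) - log (1 + 0 / ((k : ℂ) + 1)) := by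
    simp [summable_zero]
  have hsum := summable_const_mul_one_div_succ_sq (2 * (‖s‖ + 1))
  obtain ⟨g, hg⟩ : ∃ g : ℕ → ℂ → ℂ,
    g = fun (k : ℕ) (z : ℂ) => z / ((k : ℂ) + 1) - log (1 + z / ((k : ℂ) + 1)) := ⟨_, rfl⟩
  obtain ⟨g', hg'⟩ : ∃ g' : ℕ → ℂ → ℂ,
    g' = fun (k : ℕ) (z : ℂ) => 1 / ((k : ℂ) + 1) - 1 / ((k : ℂ) + 1 + z) := ⟨_, rfl⟩
  have hb' : ∀ (k : ℕ), ∀ z ∈ t, ‖g' k z‖ ≤ 2 * (‖s‖ + 1) * (1 / ((k : ℝ) + 1) ^ 2) := by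
    rw [hg']; exact hb
  have hd' : ∀ (k : ℕ), ∀ z ∈ t, HasDerivAt (g k) (g' k z) z := by rw [hg, hg']; exact hd
  have hs0' : Summable fun k => g k 0 := by rw [hg]; exact hs0
  have h1 : Summable fun k => g k s :=
    summable_of_summable_hasDerivAt_of_isPreconnected hsum ho hc hd' hb' h0 hs0' hst
  have h2 : HasDerivAt (fun z => ∑' k, g k z) (∑' k, g' k s) s :=
    hasDerivAt_tsum_of_isPreconnected hsum ho hc hd' hb' h0 hs0' hst
  rw [hg] at h1 h2
  rw [hg'] at h2
  exact ⟨h1, h2⟩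

lemma exp_sum_sub_log {s : ℂ} (hs : 0 < s.re) {n : ℕ} (hn : n ≠ 0) :
    exp (∑ k ∈ Finset.range n, (s / ((k : ℂ) + 1) - log (1 + s / ((k : ℂ) + 1))))
      = s * GammaSeq s n * exp (s * ((harmonic n - Real.log n : ℝ) : ℂ)) := by
  have hs0 : s ≠ 0 := by rintro rfl; simp at hs
  have hk0 : ∀ k : ℕ, (k : ℂ) + 1 ≠ 0 := fun k => by exact_mod_cast Nat.succ_ne_zero k
  have hne : ∀ k : ℕ, s + ((k : ℂ) + 1) ≠ 0 := fun k h => by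
    have := congrArg Complex.re h
    simp at this
    have : (0 : ℝ) ≤ k := k.cast_nonneg
    linarith
  have h1 : ∀ k : ℕ, 1 + s / ((k : ℂ) + 1) = (s + ((k : ℂ) + 1)) / ((k : ℂ) + 1) := fun k => by
    have := hk0 k
    field_simp
    ring
  have hfact : ((n.factorial : ℕ) : ℂ) = ∏ k ∈ Finset.range n, ((k : ℂ) + 1) := by
    rw [← Finset.prod_range_add_one_eq_factorial]; push_cast; rfl
  have hH : ((harmonic n : ℚ) : ℂ) = ∑ k ∈ Finset.range n, 1 / ((k : ℂ) + 1) := by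
    simp [harmonic]
  rw [Finset.sum_sub_distrib, Complex.exp_sub, Complex.exp_sum _ (fun k : ℕ => log _)]
  have h2 : ∀ k : ℕ, exp (log (1 + s / ((k : ℂ) + 1))) = (s + ((k : ℂ) + 1)) / ((k : ℂ) + 1) :=
    fun k => by
      rw [Complex.exp_log, h1]
      rw [h1]
      exact div_ne_zero (hne k) (hk0 k)
  simp only [h2]
  rw [Finset.prod_div_distrib, ← hfact, GammaSeq, Finset.prod_range_succ']
  push_cast
  rw [hH, cpow_def_of_ne_zero (Nat.cast_ne_zero.mpr hn), ← Complex.natCast_log, mul_sub,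
    Complex.exp_sub, Finset.mul_sum, mul_comm (Real.log n : ℂ) s]
  simp only [mul_one_div, add_zero]
  have h3 : ∏ k ∈ Finset.range n, (s + ((k : ℂ) + 1)) ≠ 0 :=
    Finset.prod_ne_zero_iff.mpr fun k _ => hne k
  have h4 := Complex.exp_ne_zero (s * (Real.log n : ℂ))
  field_simp

lemma exp_tsum_sub_log {s : ℂ} (hs : 0 < s.re) :
    exp (∑' k : ℕ, (s / ((k : ℂ) + 1) - log (1 + s / ((k : ℂ) + 1))))
      = s * Gamma s * exp (s * (Real.eulerMascheroniConstant : ℂ)) := by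
  have h1 := (hasDerivAt_tsum_sub_log hs).1.hasSum.tendsto_sum_nat
  have h2 := (Complex.continuous_exp.tendsto _).comp h1
  have h3 : Tendsto (fun n : ℕ => ((harmonic n - Real.log n : ℝ) : ℂ)) atTop
      (𝓝 (Real.eulerMascheroniConstant : ℂ)) :=
    (Complex.continuous_ofReal.tendsto _).comp Real.tendsto_harmonic_sub_log
  have h4 := ((GammaSeq_tendsto_Gamma s).const_mul s).mul
    ((Complex.continuous_exp.tendsto _).comp (h3.const_mul s))
  refine tendsto_nhds_unique (h2.congr' ?_) h4
  filter_upwards [eventually_ne_atTop 0] with n hn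
  exact exp_sum_sub_log hs hn

theorem digamma_eq_tsum {s : ℂ} (hs : 0 < s.re) :
    digamma s = -(Real.eulerMascheroniConstant : ℂ) - 1 / s
      + ∑' k : ℕ, (1 / ((k : ℂ) + 1) - 1 / ((k : ℂ) + 1 + s)) := by
  have hs0 : s ≠ 0 := by rintro rfl; simp at hs
  have hopen : {z : ℂ | 0 < z.re} ∈ 𝓝 s := (isOpen_lt continuous_const continuous_re).mem_nhds hs
  have h1 := (hasDerivAt_tsum_sub_log hs).2.cexp
  have hΓ : DifferentiableAt ℂ Gamma s := differentiableAt_Gamma s fun m h => by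
    rw [h] at hs
    simp at hs
    linarith [m.cast_nonneg (α := ℝ)]
  have h2 := ((hasDerivAt_id s).mul hΓ.hasDerivAt).mul
    (((hasDerivAt_id s).mul_const (Real.eulerMascheroniConstant : ℂ)).cexp)
  have heq : (fun z => exp (∑' k : ℕ, (z / ((k : ℂ) + 1) - log (1 + z / ((k : ℂ) + 1)))))
      =ᶠ[𝓝 s] (id * Gamma * fun z => exp (id z * (Real.eulerMascheroniConstant : ℂ))) := by
    filter_upwards [hopen] with z hz using exp_tsum_sub_log hz
  have h3 := h1.unique (h2.congr_of_eventuallyEq heq)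
  rw [exp_tsum_sub_log hs] at h3
  have hΓ0 : Gamma s ≠ 0 := Gamma_ne_zero_of_re_pos hs
  have he := Complex.exp_ne_zero (s * (Real.eulerMascheroniConstant : ℂ))
  rw [digamma_def, logDeriv_apply]
  simp only [id, Pi.mul_apply] at h3
  have h4 : s * Gamma s * ∑' k : ℕ, (1 / ((k : ℂ) + 1) - 1 / ((k : ℂ) + 1 + s))
      = Gamma s + s * deriv Gamma s + s * Gamma s * (Real.eulerMascheroniConstant : ℂ) := by
    apply mul_left_cancel₀ he
    linear_combination h3
  generalize ∑' k : ℕ, (1 / ((k : ℂ) + 1) - 1 / ((k : ℂ) + 1 + s)) = S at h4 ⊢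
  field_simp
  linear_combination -h4

/-! ### The logarithmic derivative of `Xi` to the right of the critical strip -/

/-- The constant `-(log π + γ) / 2`. -/
noncomputable def archConst : ℝ := -(Real.log Real.pi + Real.eulerMascheroniConstant) / 2

lemma logDeriv_Xi_eq {s : ℂ} (hs : 1 < s.re) :
    logDeriv Xi s = 1 / (s - 1) + archConst
      + ∑' k : ℕ, (1 / (2 * ((k : ℂ) + 1)) - 1 / (2 * ((k : ℂ) + 1) + s))
      + deriv riemannZeta s / riemannZeta s := by
  have h0 : s ≠ 0 := by rintro rfl; norm_num at hs
  have h1 : s ≠ 1 := by rintro rfl; norm_num at hs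
  have h1' : s - 1 ≠ 0 := sub_ne_zero.mpr h1
  have hs2 : 0 < (s / 2).re := by simp; linarith
  have hζ := riemannZeta_ne_zero_of_one_lt_re hs
  have hΓ0 : Gamma (s / 2) ≠ 0 := Gamma_ne_zero_of_re_pos hs2
  have hπ0 : (Real.pi : ℂ) ≠ 0 := by exact_mod_cast Real.pi_ne_zero
  have hΓd : DifferentiableAt ℂ Gamma (s / 2) := differentiableAt_Gamma _ fun m h => by
    rw [h] at hs2
    simp at hs2
    linarith [m.cast_nonneg (α := ℝ)]
  have hhalf : HasDerivAt (fun z : ℂ => z / 2) (1 / 2) s := (hasDerivAt_id s).div_const 2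
  have hneg : HasDerivAt (fun z : ℂ => -z / 2) (-1 / 2) s := (hasDerivAt_id s).neg.div_const 2
  have hG := hΓd.hasDerivAt.comp s hhalf
  have hP := hneg.const_cpow (c := (Real.pi : ℂ)) (Or.inl hπ0)
  have hZ := (differentiableAt_riemannZeta h1).hasDerivAt
  have hA := (hasDerivAt_id s).mul ((hasDerivAt_id s).sub_const 1)
  have hX := hA.mul ((hP.mul hG).mul hZ)
  have heq : Xi =ᶠ[𝓝 s] (id * fun z : ℂ => id z - 1) *
      (((fun z : ℂ => (Real.pi : ℂ) ^ (-z / 2)) * (Gamma ∘ fun z : ℂ => z / 2)) * riemannZeta) := by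
    filter_upwards [isOpen_ne.mem_nhds h0, isOpen_ne.mem_nhds h1,
      (isOpen_lt continuous_const continuous_re).mem_nhds hs] with z hz0 hz1 hzre
    have hz : Gammaℝ z ≠ 0 := Gammaℝ_ne_zero_of_re_pos (by linarith)
    rw [Xi_eq_mul_completedRiemannZeta hz0 hz1]
    simp only [Pi.mul_apply, id, Function.comp, ← Gammaℝ_def]
    rw [riemannZeta_def_of_ne_zero hz0, mul_div_cancel₀ _ hz]
  have hX' := hX.congr_of_eventuallyEq heq
  have hπs : (Real.pi : ℂ) ^ (-s / 2) ≠ 0 := by simp [cpow_eq_zero_iff, hπ0]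
  have hdig := digamma_eq_tsum hs2
  rw [digamma_def, logDeriv_apply] at hdig
  have htsum : ∑' k : ℕ, (1 / (2 * ((k : ℂ) + 1)) - 1 / (2 * ((k : ℂ) + 1) + s))
      = 1 / 2 * ∑' k : ℕ, (1 / ((k : ℂ) + 1) - 1 / ((k : ℂ) + 1 + s / 2)) := by
    rw [← tsum_mul_left]
    congr 1 with k
    have h5 : 2 * ((k : ℂ) + 1) + s = 2 * ((k : ℂ) + 1 + s / 2) := by ring
    rw [h5, one_div, one_div, mul_inv, mul_inv]
    ring
  have hd : deriv Gamma (s / 2) = Gamma (s / 2) * (-(Real.eulerMascheroniConstant : ℂ) - 1 / (s / 2)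
      + ∑' k : ℕ, (1 / ((k : ℂ) + 1) - 1 / ((k : ℂ) + 1 + s / 2))) := by
    rw [← hdig, mul_div_cancel₀ _ hΓ0]
  rw [logDeriv_apply, hX'.deriv, heq.self_of_nhds, htsum]
  simp only [Pi.mul_apply, id, Function.comp, archConst, hd]
  push_cast
  rw [Complex.ofReal_log Real.pi_pos.le]
  set S := ∑' k : ℕ, (1 / ((k : ℂ) + 1) - 1 / ((k : ℂ) + 1 + s / 2))
  field_simp
  ring

/-! ### Laplace transforms -/

/-- The Laplace transform of `f` converges absolutely at `s`, and its value is `a`. -/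
def HasLaplace (f : ℝ → ℂ) (s a : ℂ) : Prop :=
  IntegrableOn (fun u : ℝ => exp (-s * u) * f u) (Ioi 0) ∧
    ∫ u : ℝ in Ioi 0, exp (-s * u) * f u = a

lemma HasLaplace.add {f g : ℝ → ℂ} {s a b : ℂ} (hf : HasLaplace f s a) (hg : HasLaplace g s b) :
    HasLaplace (fun u => f u + g u) s (a + b) := by
  refine ⟨?_, ?_⟩
  · simp only [mul_add]; exact hf.1.add hg.1
  · simp only [mul_add]
    rw [integral_add hf.1 hg.1, hf.2, hg.2]

lemma HasLaplace.const_mul {f : ℝ → ℂ} {s a : ℂ} (hf : HasLaplace f s a) (c : ℂ) :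
    HasLaplace (fun u => c * f u) s (c * a) := by
  refine ⟨?_, ?_⟩
  · simp only [mul_left_comm _ c]; exact hf.1.const_mul c
  · simp only [mul_left_comm _ c]
    rw [integral_const_mul, hf.2]

lemma HasLaplace.sub {f g : ℝ → ℂ} {s a b : ℂ} (hf : HasLaplace f s a) (hg : HasLaplace g s b) :
    HasLaplace (fun u => f u - g u) s (a - b) := by
  simpa [sub_eq_add_neg] using hf.add (hg.const_mul (-1))

lemma hasLaplace_exp {a s : ℂ} (h : a.re < s.re) :
    HasLaplace (fun u => exp (a * u)) s (1 / (s - a)) := by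
  have h1 : (a - s).re < 0 := by simp; linarith
  have h2 : ∀ u : ℝ, exp (-s * u) * exp (a * u) = exp ((a - s) * u) := fun u => by
    rw [← Complex.exp_add]; ring_nf
  refine ⟨?_, ?_⟩
  · simp only [h2]; exact integrableOn_exp_mul_complex_Ioi h1 0
  · simp only [h2]
    rw [integral_exp_mul_complex_Ioi h1 0, ← neg_sub s a, div_neg]
    simp [neg_div]

lemma hasLaplace_one {s : ℂ} (hs : 0 < s.re) : HasLaplace (fun _ => 1) s (1 / s) := by
  simpa using hasLaplace_exp (a := 0) (by simpa using hs)

lemma hasLaplace_mul_exp {s : ℂ} (hs : s.re = 2) :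
    HasLaplace (fun u => u * exp u) s (1 / (s - 1) ^ 2) := by
  have h1 : 0 < (s - 1).re := by norm_num [hs]
  have h2 : ∀ u : ℝ, exp (-s * u) * (u * exp u) = u * exp (-((s - 1) * u)) := fun u => by
    rw [mul_left_comm, ← Complex.exp_add]; ring_nf
  have h3 : ∀ u : ℝ, 0 < u → ‖(u : ℂ) * exp (-((s - 1) * u))‖ ≤ 2 * Real.exp (-(1 / 2) * u) := by
    intro u hu
    rw [norm_mul, Complex.norm_exp, Complex.norm_real, Real.norm_eq_abs, abs_of_pos hu]
    have h4 : (-((s - 1) * u)).re = -(1 / 2) * u + -(1 / 2) * u := by simp [hs]; ring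
    rw [h4, Real.exp_add, ← mul_assoc]
    gcongr
    have h5 := Real.add_one_le_exp (1 / 2 * u)
    have h6 : Real.exp (1 / 2 * u) * Real.exp (-(1 / 2) * u) = 1 := by
      rw [← Real.exp_add]; simp
    nlinarith [Real.exp_pos (-(1 / 2) * u)]
  have h7 : IntegrableOn (fun u : ℝ => (u : ℂ) * exp (-((s - 1) * u))) (Ioi 0) := by
    refine Integrable.mono' ((integrableOn_exp_mul_Ioi (a := -(1 / 2)) (by norm_num) 0).const_mul 2)
      (by fun_prop) ?_
    exact (ae_restrict_iff' measurableSet_Ioi).mpr (Eventually.of_forall h3)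
  refine ⟨by simpa only [h2] using h7, ?_⟩
  simp only [h2]
  have ha : s - 1 ≠ 0 := fun h => by rw [h] at h1; simp at h1
  have hexp : Tendsto (fun u : ℝ => 2 * Real.exp (-(1 / 2) * u)) atTop (𝓝 0) := by
    have : Tendsto (fun u : ℝ => -(1 / 2) * u) atTop atBot :=
      tendsto_id.const_mul_atTop_of_neg (by norm_num)
    simpa using (Real.tendsto_exp_atBot.comp this).const_mul 2
  have h9 : Tendsto (fun u : ℝ => (u : ℂ) * exp (-((s - 1) * u))) atTop (𝓝 0) :=
    squeeze_zero_norm' ((eventually_gt_atTop 0).mono h3) hexp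
  have h10 : Tendsto (fun u : ℝ => exp (-((s - 1) * u))) atTop (𝓝 0) := by
    refine squeeze_zero_norm' ?_ (tendsto_zero_iff_norm_tendsto_zero.mp h9)
    filter_upwards [eventually_ge_atTop 1] with u hu
    rw [norm_mul, Complex.norm_real, Real.norm_eq_abs, abs_of_nonneg (by linarith)]
    exact le_mul_of_one_le_left (norm_nonneg _) hu
  have hd : ∀ u ∈ Ici (0 : ℝ), HasDerivAt
      (fun u : ℝ => -(1 / (s - 1)) * ((u : ℂ) * exp (-((s - 1) * u)))
        + -(1 / (s - 1) ^ 2) * exp (-((s - 1) * u)))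
      ((u : ℂ) * exp (-((s - 1) * u))) u := fun u _ => by
    have e1 : HasDerivAt (fun u : ℝ => (u : ℂ)) 1 u := Complex.ofRealCLM.hasDerivAt
    have e2 := (e1.const_mul (s - 1)).neg.cexp
    refine (((e1.mul e2).const_mul (-(1 / (s - 1)))).add
      (e2.const_mul (-(1 / (s - 1) ^ 2)))).congr_deriv ?_
    simp only [Pi.neg_apply]
    field_simp
    ring
  have hlim := (h9.const_mul (-(1 / (s - 1)))).add (h10.const_mul (-(1 / (s - 1) ^ 2)))
  rw [integral_Ioi_of_hasDerivAt_of_tendsto' hd h7 hlim]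
  simp

lemma hasLaplace_max_exp_sub_one {s : ℂ} (hs : s.re = 2) {n : ℕ} (hn : n ≠ 0) :
    HasLaplace (fun u => ((max (Real.exp u / n - 1) 0 : ℝ) : ℂ)) s
      ((n : ℂ) ^ (-s) * (1 / (s - 1) - 1 / s)) := by
  have hn0 : (0 : ℝ) < n := by positivity
  have hn0' : (n : ℂ) ≠ 0 := Nat.cast_ne_zero.mpr hn
  have hl0 : 0 ≤ Real.log n := Real.log_natCast_nonneg n
  have h1 : (1 - s).re < 0 := by norm_num [hs]
  have h2 : (-s).re < 0 := by simp [hs]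
  have hs0 : s ≠ 0 := by rintro rfl; norm_num at hs
  have hs1 : s - 1 ≠ 0 := by
    intro h; rw [sub_eq_zero.mp h] at hs; norm_num at hs
  set g : ℝ → ℂ := fun u => exp ((1 - s) * u) * (n : ℂ)⁻¹ - exp (-s * u)
  have hg : IntegrableOn g (Ioi (Real.log n)) :=
    ((integrableOn_exp_mul_complex_Ioi h1 _).mul_const _).sub (integrableOn_exp_mul_complex_Ioi h2 _)
  have hgi : ∫ u in Ioi (Real.log n), g u = (n : ℂ) ^ (-s) * (1 / (s - 1) - 1 / s) := by
    rw [integral_sub ((integrableOn_exp_mul_complex_Ioi h1 _).mul_const _)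
      (integrableOn_exp_mul_complex_Ioi h2 _), integral_mul_const, integral_exp_mul_complex_Ioi h1,
      integral_exp_mul_complex_Ioi h2, cpow_def_of_ne_zero hn0', ← Complex.natCast_log]
    have h3 : exp ((1 - s) * (Real.log n : ℂ)) = n * exp (-s * (Real.log n : ℂ)) := by
      rw [sub_mul, one_mul, sub_eq_add_neg, Complex.exp_add, ← neg_mul, Complex.natCast_log,
        Complex.exp_log hn0']
    rw [h3, mul_comm (Real.log n : ℂ) (-s)]
    have h4 : 1 - s ≠ 0 := by rw [← neg_sub]; exact neg_ne_zero.mpr hs1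
    rw [← neg_sub s 1]
    field_simp
  have heq : ∀ u : ℝ, exp (-s * u) * ((max (Real.exp u / n - 1) 0 : ℝ) : ℂ)
      = (Ioi (Real.log n)).indicator g u := fun u => by
    rcases lt_or_ge (Real.log n) u with h | h
    · rw [indicator_of_mem (mem_Ioi.mpr h)]
      have h5 : 1 ≤ Real.exp u / n := by
        rw [le_div_iff₀ hn0, one_mul]
        exact ((Real.log_lt_iff_lt_exp hn0).mp h).le
      rw [max_eq_left (by linarith)]
      simp only [g, sub_eq_add_neg, add_mul, one_mul, Complex.exp_add]
      push_cast
      ring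
    · rw [indicator_of_notMem (by simpa using h)]
      have h5 : Real.exp u / n ≤ 1 := by
        rw [div_le_iff₀ hn0, one_mul]
        exact (Real.le_log_iff_exp_le hn0).mp h
      rw [max_eq_right (by linarith)]
      simp
  refine ⟨?_, ?_⟩
  · simp only [heq]
    exact (hg.integrable_indicator measurableSet_Ioi).integrableOn
  · simp only [heq]
    rw [setIntegral_indicator measurableSet_Ioi, inter_eq_right.mpr (Ioi_subset_Ioi hl0), hgi]

lemma norm_exp_mul_le {s : ℂ} (hs : s.re = 2) {z : ℂ} {c u : ℝ}
    (h : ‖z‖ ≤ c * Real.exp (3 / 2 * u)) :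
    ‖exp (-s * u) * z‖ ≤ c * Real.exp (-(1 / 2) * u) := by
  rw [norm_mul, Complex.norm_exp]
  have h1 : (-s * u).re = -2 * u := by simp [hs]
  have h2 : -(1 / 2) * u = -2 * u + 3 / 2 * u := by ring
  rw [h1, h2, Real.exp_add]
  calc _ ≤ Real.exp (-2 * u) * (c * Real.exp (3 / 2 * u)) := by gcongr
    _ = _ := by ring

lemma continuousOn_tsum_of_exp_bound {ι : Type*} {F : ι → ℝ → ℂ} {c : ι → ℝ} (hc : Summable c)
    (hF : ∀ i, Continuous (F i)) (hb : ∀ i u, 0 ≤ u → ‖F i u‖ ≤ c i * Real.exp (3 / 2 * u)) :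
    ContinuousOn (fun u => ∑' i, F i u) (Ici 0) := by
  have h1 : ContinuousOn (fun u : ℝ => ∑' i, exp (-(3 / 2) * u) * F i u) (Ici 0) := by
    refine continuousOn_tsum (fun i => ?_) hc fun i u hu => ?_
    · have := hF i
      fun_prop
    · rw [norm_mul, Complex.norm_exp]
      have h2 : (-(3 / 2) * (u : ℂ)).re = -(3 / 2 * u) := by simp
      rw [h2]
      calc _ ≤ Real.exp (-(3 / 2 * u)) * (c i * Real.exp (3 / 2 * u)) := by gcongr; exact hb i u hu
        _ = _ := by rw [mul_left_comm, ← Real.exp_add]; simp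
  have h3 : ContinuousOn (fun u : ℝ => exp (3 / 2 * u) * ∑' i, exp (-(3 / 2) * u) * F i u) (Ici 0) :=
    ContinuousOn.mul (by fun_prop) h1
  refine h3.congr fun u _ => ?_
  simp only []
  rw [tsum_mul_left, ← mul_assoc, ← Complex.exp_add]
  simp

lemma HasLaplace.tsum {ι : Type*} [Countable ι] {F : ι → ℝ → ℂ} {c : ι → ℝ} {s : ℂ} {a : ι → ℂ}
    (hs : s.re = 2) (hc : Summable c) (hcont : ∀ i, Continuous (F i))
    (hF : ∀ i, HasLaplace (F i) s (a i))
    (hb : ∀ i u, 0 ≤ u → ‖F i u‖ ≤ c i * Real.exp (3 / 2 * u)) :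
    HasLaplace (fun u => ∑' i, F i u) s (∑' i, a i) := by
  have hI := integrableOn_exp_mul_Ioi (a := -(1 / 2)) (by norm_num) 0
  have hle : ∀ i, ∀ᵐ u : ℝ ∂(volume.restrict (Ioi (0 : ℝ))),
      ‖exp (-s * u) * F i u‖ ≤ c i * Real.exp (-(1 / 2) * u) := fun i =>
    (ae_restrict_iff' measurableSet_Ioi).mpr (Eventually.of_forall fun u hu =>
      norm_exp_mul_le hs (hb i u (le_of_lt hu)))
  have hsum : Summable fun i => ∫ u : ℝ in Ioi (0 : ℝ), ‖exp (-s * u) * F i u‖ := by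
    refine Summable.of_nonneg_of_le (fun i => integral_nonneg fun u => norm_nonneg _) (fun i => ?_)
      (hc.mul_right (∫ u : ℝ in Ioi (0 : ℝ), Real.exp (-(1 / 2) * u)))
    rw [← integral_const_mul]
    exact integral_mono_ae (hF i).1.norm (hI.const_mul _) (hle i)
  have h1 := hasSum_integral_of_summable_integral_norm (fun i => (hF i).1) hsum
  have hsumF : ∀ u : ℝ, 0 ≤ u → Summable fun i => F i u := fun u hu =>
    Summable.of_norm_bounded (hc.mul_right _) fun i => hb i u hu
  have heq : ∀ u : ℝ, ∑' i, exp (-s * u) * F i u = exp (-s * u) * ∑' i, F i u := fun u => tsum_mul_left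
  simp only [heq] at h1
  refine ⟨?_, ?_⟩
  · have hm : AEStronglyMeasurable (fun u : ℝ => exp (-s * u) * ∑' i, F i u)
        (volume.restrict (Ioi 0)) := by
      have h2 := (continuousOn_tsum_of_exp_bound hc hcont hb).mono Ioi_subset_Ici_self
      exact ((by fun_prop : Continuous fun u : ℝ => exp (-s * u)).continuousOn.mul
        h2).aestronglyMeasurable measurableSet_Ioi
    refine Integrable.mono' (hI.const_mul (∑' i, c i)) hm ?_
    refine (ae_restrict_iff' measurableSet_Ioi).mpr (Eventually.of_forall fun u hu => ?_)
    refine norm_exp_mul_le hs ?_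
    rw [← tsum_mul_right]
    exact tsum_of_norm_bounded (hc.mul_right _).hasSum fun i => hb i u (le_of_lt hu)
  · rw [← h1.tsum_eq]
    exact tsum_congr fun i => (hF i).2

/-- Uniqueness of Laplace transforms. -/
theorem eq_zero_of_hasLaplace_zero {H : ℝ → ℂ} (hc : ContinuousOn H (Ici 0)) (h0 : H 0 = 0)
    (hL : ∀ s : ℂ, s.re = 2 → HasLaplace H s 0) {u : ℝ} (hu : 0 ≤ u) : H u = 0 := by
  set f : ℝ → ℂ := fun u => exp (-2 * (max u 0 : ℝ)) * H (max u 0) with hf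
  have hfc : Continuous f := by
    have h1 : Continuous fun u : ℝ => H (max u 0) :=
      hc.comp_continuous (by fun_prop) fun u => le_max_right u 0
    exact (by fun_prop : Continuous fun u : ℝ => exp (-2 * ((max u 0 : ℝ) : ℂ))).mul h1
  have hfi : f = (Ioi 0).indicator fun u : ℝ => exp (-2 * u) * H u := by
    ext u
    rcases lt_or_ge 0 u with h | h
    · rw [indicator_of_mem (mem_Ioi.mpr h)]
      simp only [hf, max_eq_left h.le]
    · rw [indicator_of_notMem (by simpa using h)]
      simp only [hf, max_eq_right h, h0, mul_zero]
  have hint : Integrable f := by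
    rw [hfi, integrable_indicator_iff measurableSet_Ioi]
    exact (hL 2 (by simp)).1
  have hF : FourierTransform.fourier f = 0 := by
    ext ξ
    rw [Real.fourier_real_eq_integral_exp_smul, Pi.zero_apply, hfi]
    have h2 := (hL (2 + 2 * Real.pi * ξ * I) (by simp)).2
    rw [← h2, ← integral_indicator measurableSet_Ioi]
    congr 1 with u
    by_cases hu : u ∈ Ioi (0 : ℝ)
    · rw [indicator_of_mem hu, indicator_of_mem hu, smul_eq_mul, ← mul_assoc, ← Complex.exp_add]
      congr 2
      push_cast
      ring
    · rw [indicator_of_notMem hu, indicator_of_notMem hu, smul_zero]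
  have h3 := hint.fourierInv_fourier_eq (by rw [hF]; exact integrable_zero _ _ _)
    (hfc.continuousAt (x := u))
  rw [hF] at h3
  have h4 : f u = 0 := by
    rw [← h3, Real.fourierInv_eq]
    simp
  simp only [hf, max_eq_left hu, mul_eq_zero, Complex.exp_ne_zero, false_or] at h4
  exact h4

/-! ### The explicit formula -/

lemma norm_zeroTerm_le (hRH : RiemannHypothesis) (i : ZeroIndex) (u : ℝ) (hu : 0 ≤ u) :
    ‖1 / ((i.1 : ℂ) * (1 - (i.1 : ℂ))) * exp ((i.1 : ℂ) * u)‖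
      ≤ 1 / (1 / 4 + (i.1 : ℂ).im ^ 2) * Real.exp (3 / 2 * u) := by
  rw [norm_mul, norm_div, norm_one, norm_mul_one_sub hRH, Complex.norm_exp]
  have h1 : ((i.1 : ℂ) * u).re = 1 / 2 * u := by simp [re_eq_half hRH i]
  rw [h1]
  gcongr
  norm_num

/-- The contribution of the trivial zero `-2 (k + 1)` to the explicit formula. -/
noncomputable def trivialTerm (k : ℕ) (u : ℝ) : ℝ :=
  (Real.exp u - Real.exp (-(2 * ((k : ℝ) + 1)) * u)) / (2 * ((k : ℝ) + 1) * (2 * ((k : ℝ) + 1) + 1))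

/-- The contribution of the integer `n` to the explicit formula. -/
noncomputable def primeTerm (n : ℕ) (u : ℝ) : ℝ :=
  ArithmeticFunction.vonMangoldt n * max (Real.exp u / n - 1) 0

lemma norm_trivialTerm_le (k : ℕ) (u : ℝ) (hu : 0 ≤ u) :
    ‖(trivialTerm k u : ℂ)‖ ≤ 1 * (1 / ((k : ℝ) + 1) ^ 2) * Real.exp (3 / 2 * u) := by
  have hk : (0 : ℝ) < (k : ℝ) + 1 := by positivity
  have h1 : Real.exp (-(2 * ((k : ℝ) + 1)) * u) ≤ Real.exp u :=
    Real.exp_le_exp.mpr (by nlinarith)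
  have h2 : Real.exp u ≤ Real.exp (3 / 2 * u) := Real.exp_le_exp.mpr (by linarith)
  have h3 : 0 < Real.exp (-(2 * ((k : ℝ) + 1)) * u) := Real.exp_pos _
  rw [Complex.norm_real, Real.norm_eq_abs, trivialTerm, abs_of_nonneg
    (div_nonneg (by linarith) (by positivity)), one_mul, one_div_mul_eq_div]
  have h4 : ((k : ℝ) + 1) ^ 2 ≤ 2 * ((k : ℝ) + 1) * (2 * ((k : ℝ) + 1) + 1) := by nlinarith
  gcongr
  linarith

lemma hasLaplace_trivialTerm {s : ℂ} (hs : s.re = 2) (k : ℕ) :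
    HasLaplace (fun u => (trivialTerm k u : ℂ)) s
      (1 / (s * (s - 1)) * (1 / (2 * ((k : ℂ) + 1)) - 1 / (2 * ((k : ℂ) + 1) + s))) := by
  have hk : (0 : ℝ) ≤ k := k.cast_nonneg
  have h1 := hasLaplace_exp (a := 1) (s := s) (by simp [hs])
  have h2 := hasLaplace_exp (a := -(2 * ((k : ℂ) + 1))) (s := s) (by simp [hs]; linarith)
  have h3 := (h1.sub h2).const_mul (1 / (2 * ((k : ℂ) + 1) * (2 * ((k : ℂ) + 1) + 1)))
  have hs0 : s ≠ 0 := by rintro rfl; norm_num at hs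
  have hs1 : s - 1 ≠ 0 := by
    intro h; rw [sub_eq_zero.mp h] at hs; norm_num at hs
  have hk1 : (k : ℂ) + 1 ≠ 0 := by exact_mod_cast Nat.succ_ne_zero k
  have hk2 : 2 * ((k : ℂ) + 1) + 1 ≠ 0 := by
    have : 2 * (k + 1) + 1 ≠ 0 := by omega
    exact_mod_cast this
  have hk3 : 2 * ((k : ℂ) + 1) + s ≠ 0 := fun h => by
    have := congrArg Complex.re h
    simp [hs] at this
    linarith
  have hk4 : s - -(2 * ((k : ℂ) + 1)) ≠ 0 := by
    rw [sub_neg_eq_add, add_comm]; exact hk3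
  convert h3 using 1
  · ext u
    simp only [trivialTerm]
    push_cast
    rw [one_mul]
    ring
  · rw [sub_neg_eq_add] at hk4 ⊢
    field_simp
    ring

lemma norm_primeTerm_le (n : ℕ) (u : ℝ) :
    ‖(primeTerm n u : ℂ)‖
      ≤ ‖LSeries.term (fun n => ((ArithmeticFunction.vonMangoldt n : ℝ) : ℂ)) (3 / 2) n‖
        * Real.exp (3 / 2 * u) := by
  rcases eq_or_ne n 0 with rfl | hn
  · simp [primeTerm]
  have hn0 : (0 : ℝ) < n := by positivity
  have hΛ : 0 ≤ ArithmeticFunction.vonMangoldt n := ArithmeticFunction.vonMangoldt_nonneg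
  rw [LSeries.term_of_ne_zero hn, norm_div, Complex.norm_real, Complex.norm_real,
    Complex.norm_natCast_cpow_of_pos (Nat.pos_of_ne_zero hn), primeTerm, Real.norm_eq_abs,
    Real.norm_eq_abs, abs_of_nonneg hΛ, abs_of_nonneg (mul_nonneg hΛ (le_max_right _ _)),
    div_mul_eq_mul_div, mul_div_assoc]
  gcongr
  have h1 : Real.exp (3 / 2 * u) = Real.exp u ^ (3 / 2 : ℝ) := by
    rw [← Real.exp_mul]; ring_nf
  have h2 : (3 / 2 : ℂ).re = 3 / 2 := by norm_num
  rw [h1, h2, ← Real.div_rpow (Real.exp_pos u).le hn0.le]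
  have h3 : 0 < Real.exp u / n := by positivity
  refine max_le ?_ (by positivity)
  rcases le_total 1 (Real.exp u / n) with h | h
  · have := Real.rpow_le_rpow_of_exponent_le h (show (1 : ℝ) ≤ 3 / 2 by norm_num)
    rw [Real.rpow_one] at this
    linarith
  · have : 0 ≤ (Real.exp u / n) ^ (3 / 2 : ℝ) := by positivity
    linarith

lemma hasLaplace_primeTerm {s : ℂ} (hs : s.re = 2) (n : ℕ) :
    HasLaplace (fun u => (primeTerm n u : ℂ)) s
      (LSeries.term (fun n => ((ArithmeticFunction.vonMangoldt n : ℝ) : ℂ)) s n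
        * (1 / (s - 1) - 1 / s)) := by
  rcases eq_or_ne n 0 with rfl | hn
  · simp [primeTerm, HasLaplace]
  · convert (hasLaplace_max_exp_sub_one hs hn).const_mul (ArithmeticFunction.vonMangoldt n : ℂ)
      using 1
    · ext u; simp [primeTerm]
    · rw [LSeries.term_of_ne_zero hn, cpow_neg]; ring

/-- The elementary side of the explicit formula. -/
noncomputable def explicitSide (u : ℝ) : ℂ :=
  zeroConst * (1 + exp (1 * u)) + archConst * (1 - exp (1 * u))
    - (1 - exp (1 * u) + u * exp u) - ∑' k : ℕ, (trivialTerm k u : ℂ) + ∑' n : ℕ, (primeTerm n u : ℂ)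

lemma summable_vonMangoldt_three_halves :
    Summable fun n => ‖LSeries.term (fun n => ((ArithmeticFunction.vonMangoldt n : ℝ) : ℂ)) (3 / 2) n‖ :=
  (ArithmeticFunction.LSeriesSummable_vonMangoldt (s := 3 / 2) (by norm_num)).norm

lemma continuous_trivialTerm (k : ℕ) : Continuous fun u => (trivialTerm k u : ℂ) := by
  unfold trivialTerm; fun_prop

lemma continuous_primeTerm (n : ℕ) : Continuous fun u => (primeTerm n u : ℂ) := by
  unfold primeTerm; fun_prop

lemma hasLaplace_explicitSide {s : ℂ} (hs : s.re = 2) :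
    HasLaplace explicitSide s (zeroConst * (1 / s + 1 / (s - 1))
      + archConst * (1 / s - 1 / (s - 1)) - (1 / s - 1 / (s - 1) + 1 / (s - 1) ^ 2)
      - 1 / (s * (s - 1)) * ∑' k : ℕ, (1 / (2 * ((k : ℂ) + 1)) - 1 / (2 * ((k : ℂ) + 1) + s))
      + LSeries (fun n => ((ArithmeticFunction.vonMangoldt n : ℝ) : ℂ)) s * (1 / (s - 1) - 1 / s)) := by
  have h1 := hasLaplace_one (s := s) (by simp [hs])
  have h2 := hasLaplace_exp (a := 1) (s := s) (by simp [hs])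
  have h3 := hasLaplace_mul_exp hs
  have h4 := HasLaplace.tsum hs (summable_const_mul_one_div_succ_sq 1) continuous_trivialTerm
    (hasLaplace_trivialTerm hs) norm_trivialTerm_le
  have h5 := HasLaplace.tsum hs summable_vonMangoldt_three_halves continuous_primeTerm
    (hasLaplace_primeTerm hs) (fun n u _ => norm_primeTerm_le n u)
  rw [tsum_mul_left] at h4
  rw [tsum_mul_right] at h5
  exact (((((h1.add h2).const_mul zeroConst).add ((h1.sub h2).const_mul archConst)).sub
    ((h1.sub h2).add h3)).sub h4).add h5

lemma hasLaplace_zeros (hRH : RiemannHypothesis) {s : ℂ} (hs : s.re = 2) :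
    HasLaplace (fun u => ∑' i : ZeroIndex, 1 / ((i.1 : ℂ) * (1 - (i.1 : ℂ))) * exp ((i.1 : ℂ) * u)) s
      (∑' i : ZeroIndex, 1 / ((i.1 : ℂ) * (1 - (i.1 : ℂ))) * (1 / (s - (i.1 : ℂ)))) := by
  have := countable_zeroIndex hRH
  refine HasLaplace.tsum hs (summable_inv_quarter_add hRH) (fun i => by fun_prop)
    (fun i => (hasLaplace_exp ?_).const_mul _) (norm_zeroTerm_le hRH)
  rw [hs, re_eq_half hRH]
  norm_num

/-- The explicit formula for `∑ e ^ (u ρ) / (ρ (1 - ρ))`. -/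
theorem tsum_zeros_exp_eq (hRH : RiemannHypothesis) {u : ℝ} (hu : 0 ≤ u) :
    ∑' i : ZeroIndex, 1 / ((i.1 : ℂ) * (1 - (i.1 : ℂ))) * exp ((i.1 : ℂ) * u) = explicitSide u := by
  have hcG := continuousOn_tsum_of_exp_bound (summable_inv_quarter_add hRH)
    (F := fun (i : ZeroIndex) (u : ℝ) => 1 / ((i.1 : ℂ) * (1 - (i.1 : ℂ))) * exp ((i.1 : ℂ) * u))
    (fun i => by fun_prop) (norm_zeroTerm_le hRH)
  have hcT := continuousOn_tsum_of_exp_bound (summable_const_mul_one_div_succ_sq 1)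
    continuous_trivialTerm norm_trivialTerm_le
  have hcP := continuousOn_tsum_of_exp_bound summable_vonMangoldt_three_halves
    continuous_primeTerm (fun n u _ => norm_primeTerm_le n u)
  have hcE : ContinuousOn explicitSide (Ici 0) := by
    unfold explicitSide
    exact (ContinuousOn.sub (by fun_prop) hcT).add hcP
  have hP0 : ∀ n : ℕ, primeTerm n 0 = 0 := fun n => by
    rcases eq_or_ne n 0 with rfl | hn
    · simp [primeTerm]
    · have hn0 : (0 : ℝ) < n := by positivity
      have : 1 / (n : ℝ) ≤ 1 := by
        rw [div_le_one hn0]; exact_mod_cast Nat.one_le_iff_ne_zero.mpr hn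
      rw [primeTerm, Real.exp_zero, max_eq_right (by linarith), mul_zero]
  have h0 : ∑' i : ZeroIndex, 1 / ((i.1 : ℂ) * (1 - (i.1 : ℂ))) * exp ((i.1 : ℂ) * (0 : ℝ))
      - explicitSide 0 = 0 := by
    simp [explicitSide, trivialTerm, hP0, zeroConst]
    ring
  have key := eq_zero_of_hasLaplace_zero (H := fun u : ℝ =>
    ∑' i : ZeroIndex, 1 / ((i.1 : ℂ) * (1 - (i.1 : ℂ))) * exp ((i.1 : ℂ) * u) - explicitSide u)
    (hcG.sub hcE) h0 (fun s hs => ?_) hu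
  · exact sub_eq_zero.mp key
  · have h := (hasLaplace_zeros hRH hs).sub (hasLaplace_explicitSide hs)
    have hs1' : 1 < s.re := by rw [hs]; norm_num
    have hs0 : s ≠ 0 := by rintro rfl; norm_num at hs
    have hs1 : s - 1 ≠ 0 := by
      intro h; rw [sub_eq_zero.mp h] at hs; norm_num at hs
    have e1 := tsum_zeros_cauchy hRH hs1'
    rw [logDeriv_Xi_eq hs1'] at e1
    have e2 := ArithmeticFunction.LSeries_vonMangoldt_eq_deriv_riemannZeta_div hs1'
    rw [neg_div] at e2
    convert h using 1
    rw [e2, eq_comm, sub_eq_zero]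
    generalize deriv riemannZeta s / riemannZeta s = D at e1 ⊢
    generalize ∑' k : ℕ, (1 / (2 * ((k : ℂ) + 1)) - 1 / (2 * ((k : ℂ) + 1) + s)) = S at e1 ⊢
    have hs1'' : 1 - s ≠ 0 := by rw [← neg_sub]; exact neg_ne_zero.mpr hs1
    rw [← mul_right_inj' (mul_ne_zero hs0 hs1''), e1, ← neg_sub s 1]
    field_simp
    ring

/-! ### The contribution of the trivial zeros in closed form -/

lemma hasSum_trivial_of_lt_one {q : ℝ} (h0 : 0 ≤ q) (h1 : q < 1) :
    HasSum (fun k : ℕ => q ^ (2 * k + 3) / (2 * ((k : ℝ) + 1) * (2 * ((k : ℝ) + 1) + 1)))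
      (q + 1 / 2 * ((1 - q) * Real.log (1 - q)) - 1 / 2 * ((1 + q) * Real.log (1 + q))) := by
  have hq : |q| < 1 := by rwa [abs_of_nonneg h0]
  have hq2 : |q ^ 2| < 1 := by
    rw [abs_of_nonneg (by positivity)]; nlinarith
  have e1 := (Real.hasSum_pow_div_log_of_abs_lt_one hq2).mul_left (q / 2)
  have e2 := (hasSum_nat_add_iff' 1).mpr (Real.hasSum_log_sub_log_of_abs_lt_one hq)
  have e3 := e1.sub (e2.mul_left (1 / 2))
  have hlog : Real.log (1 - q ^ 2) = Real.log (1 - q) + Real.log (1 + q) := by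
    rw [← Real.log_mul (by linarith) (by linarith)]; ring_nf
  rw [hlog] at e3
  have hval : q / 2 * -(Real.log (1 - q) + Real.log (1 + q)) - 1 / 2 * (Real.log (1 + q)
      - Real.log (1 - q) - ∑ i ∈ Finset.range 1, 2 * (1 / (2 * (i : ℝ) + 1)) * q ^ (2 * i + 1))
      = q + 1 / 2 * ((1 - q) * Real.log (1 - q)) - 1 / 2 * ((1 + q) * Real.log (1 + q)) := by
    simp only [Finset.sum_range_one, Nat.cast_zero]
    ring
  rw [hval] at e3
  refine e3.congr_fun fun k => ?_
  have hk : (k : ℝ) + 1 ≠ 0 := by positivity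
  have hk' : 2 * ((k : ℝ) + 1) + 1 ≠ 0 := by positivity
  push_cast
  field_simp
  ring

lemma hasSum_trivial {q : ℝ} (h0 : 0 ≤ q) (h1 : q ≤ 1) :
    HasSum (fun k : ℕ => q ^ (2 * k + 3) / (2 * ((k : ℝ) + 1) * (2 * ((k : ℝ) + 1) + 1)))
      (q + 1 / 2 * ((1 - q) * Real.log (1 - q)) - 1 / 2 * ((1 + q) * Real.log (1 + q))) := by
  have hb : ∀ (k : ℕ), ∀ q ∈ Icc (0 : ℝ) 1,
      ‖q ^ (2 * k + 3) / (2 * ((k : ℝ) + 1) * (2 * ((k : ℝ) + 1) + 1))‖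
        ≤ 1 * (1 / ((k : ℝ) + 1) ^ 2) := fun k q hq => by
    have hk : (0 : ℝ) < (k : ℝ) + 1 := by positivity
    have h2 := hq.1
    rw [Real.norm_eq_abs, abs_of_nonneg (by positivity), one_mul]
    have h4 : ((k : ℝ) + 1) ^ 2 ≤ 2 * ((k : ℝ) + 1) * (2 * ((k : ℝ) + 1) + 1) := by nlinarith
    have h5 : q ^ (2 * k + 3) ≤ 1 := pow_le_one₀ h2 hq.2
    gcongr
  have hs := summable_const_mul_one_div_succ_sq 1
  have hc := continuousOn_tsum (s := Icc (0 : ℝ) 1)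
    (f := fun (k : ℕ) (q : ℝ) => q ^ (2 * k + 3) / (2 * ((k : ℝ) + 1) * (2 * ((k : ℝ) + 1) + 1)))
    (fun k => by fun_prop) hs hb
  have hg : Continuous fun q : ℝ =>
      q + 1 / 2 * ((1 - q) * Real.log (1 - q)) - 1 / 2 * ((1 + q) * Real.log (1 + q)) := by
    have e1 := Real.continuous_mul_log.comp (by fun_prop : Continuous fun q : ℝ => 1 - q)
    have e2 := Real.continuous_mul_log.comp (by fun_prop : Continuous fun q : ℝ => 1 + q)
    simp only [Function.comp_def] at e1 e2
    fun_prop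
  have heq : EqOn (fun q : ℝ =>
      ∑' k : ℕ, q ^ (2 * k + 3) / (2 * ((k : ℝ) + 1) * (2 * ((k : ℝ) + 1) + 1))) (fun q : ℝ =>
      q + 1 / 2 * ((1 - q) * Real.log (1 - q)) - 1 / 2 * ((1 + q) * Real.log (1 + q))) (Ico 0 1) :=
    fun q hq => (hasSum_trivial_of_lt_one hq.1 hq.2).tsum_eq
  have h2 := heq.of_subset_closure hc hg.continuousOn Ico_subset_Icc_self
    (by rw [closure_Ico (by norm_num)]) ⟨h0, h1⟩
  simp only [] at h2
  rw [← h2]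
  exact (Summable.of_norm_bounded hs fun k => hb k q ⟨h0, h1⟩).hasSum

lemma tsum_trivialTerm {x y : ℝ} (hy : 0 < y) (hxy : y ≤ x) :
    y * ∑' k : ℕ, trivialTerm k (Real.log (x / y))
      = x * (1 - Real.log 2) - y - 1 / 2 * ((x - y) * (Real.log (x - y) - Real.log x))
        + 1 / 2 * ((x + y) * (Real.log (x + y) - Real.log x)) := by
  have hx : 0 < x := lt_of_lt_of_le hy hxy
  have hq1 : y / x ≤ 1 := (div_le_one hx).mpr hxy
  have h1 := (hasSum_trivial (q := 1) zero_le_one le_rfl).sub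
    (hasSum_trivial (q := y / x) (by positivity) hq1)
  have h2 := h1.mul_left (x / y)
  have heq : ∀ k : ℕ, trivialTerm k (Real.log (x / y))
      = x / y * ((1 : ℝ) ^ (2 * k + 3) / (2 * ((k : ℝ) + 1) * (2 * ((k : ℝ) + 1) + 1))
        - (y / x) ^ (2 * k + 3) / (2 * ((k : ℝ) + 1) * (2 * ((k : ℝ) + 1) + 1))) := fun k => by
    have h3 : Real.exp (-(2 * ((k : ℝ) + 1)) * Real.log (x / y)) = (y / x) ^ (2 * (k + 1)) := by
      have h4 : -(2 * ((k : ℝ) + 1)) * Real.log (x / y)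
          = ((2 * (k + 1) : ℕ) : ℝ) * Real.log (y / x) := by
        rw [← inv_div y x, Real.log_inv]; push_cast; ring
      rw [h4, Real.exp_nat_mul, Real.exp_log (by positivity)]
    rw [trivialTerm, h3, Real.exp_log (by positivity)]
    have h5 : (y / x) ^ (2 * k + 3) = (y / x) ^ (2 * (k + 1)) * (y / x) := by
      rw [← pow_succ, mul_add]
    rw [h5]
    field_simp
    ring
  simp only [heq, h2.tsum_eq]
  have hl1 : (x - y) * Real.log (1 - y / x) = (x - y) * (Real.log (x - y) - Real.log x) := by
    rcases hxy.eq_or_lt with rfl | h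
    · simp
    · rw [← Real.log_div (by linarith) hx.ne']
      congr 2
      field_simp
  have hl2 : Real.log (1 + y / x) = Real.log (x + y) - Real.log x := by
    rw [← Real.log_div (by linarith) hx.ne']
    congr 1
    field_simp
  rw [hl2, ← hl1]
  norm_num
  field_simp
  ring

/-! ### The two-variable sum over zeros -/

/-- The sum `∑ x ^ ρ y ^ (1 - ρ) / (ρ (1 - ρ))` over the nontrivial zeros. -/
noncomputable def zeroKernel (x y : ℝ) : ℂ :=
  ∑' i : ZeroIndex, 1 / ((i.1 : ℂ) * (1 - (i.1 : ℂ))) * ((x : ℂ) ^ (i.1 : ℂ) * (y : ℂ) ^ (1 - (i.1 : ℂ)))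

lemma summable_zeroKernel (hRH : RiemannHypothesis) {x y : ℝ} (hx : 0 < x) (hy : 0 < y) :
    Summable fun i : ZeroIndex => 1 / ((i.1 : ℂ) * (1 - (i.1 : ℂ))) *
      ((x : ℂ) ^ (i.1 : ℂ) * (y : ℂ) ^ (1 - (i.1 : ℂ))) := by
  refine Summable.of_norm ?_
  refine ((summable_inv_quarter_add hRH).mul_right (x ^ (1 / 2 : ℝ) * y ^ (1 - 1 / 2 : ℝ))).congr
    fun i => ?_
  rw [norm_mul, norm_div, norm_one, norm_mul_one_sub hRH, norm_mul,
    Complex.norm_cpow_eq_rpow_re_of_pos hx, Complex.norm_cpow_eq_rpow_re_of_pos hy, sub_re, one_re,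
    re_eq_half hRH]

lemma zeroKernel_symm (x y : ℝ) : zeroKernel x y = zeroKernel y x := by
  rw [zeroKernel, ← reflect.tsum_eq]
  refine tsum_congr fun i => ?_
  rw [coe_reflect, sub_sub_cancel]
  ring

/-- The elementary part of `zeroKernel`. -/
noncomputable def kernelMain (x y : ℝ) : ℝ :=
  archConst * (y - x) - x * Real.log x + x * Real.log 2 + x * Real.log y + y * Real.log x
    + 1 / 2 * ((x - y) * Real.log (x - y)) - 1 / 2 * ((x + y) * Real.log (x + y))

lemma primeTerm_eq_zero {u : ℝ} (hu : Real.exp u < 2) (n : ℕ) : primeTerm n u = 0 := by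
  rcases lt_or_ge n 2 with hn | hn
  · interval_cases n <;> simp [primeTerm]
  · have hn' : (2 : ℝ) ≤ n := by exact_mod_cast hn
    have : Real.exp u / n ≤ 1 := by
      rw [div_le_one (by linarith)]; linarith
    rw [primeTerm, max_eq_right (by linarith), mul_zero]

theorem zeroKernel_eq (hRH : RiemannHypothesis) {x y : ℝ} (hy : 0 < y) (hxy : y ≤ x)
    (hxy2 : x < 2 * y) : zeroKernel x y = zeroConst * (x + y) + kernelMain x y := by
  have hx : 0 < x := lt_of_lt_of_le hy hxy
  have hu : 0 ≤ Real.log (x / y) := Real.log_nonneg ((one_le_div hy).mpr hxy)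
  have hexp : Real.exp (Real.log (x / y)) = x / y := Real.exp_log (by positivity)
  have h1 := tsum_zeros_exp_eq hRH hu
  have h2 : zeroKernel x y = y * ∑' i : ZeroIndex,
      1 / ((i.1 : ℂ) * (1 - (i.1 : ℂ))) * exp ((i.1 : ℂ) * (Real.log (x / y) : ℝ)) := by
    rw [zeroKernel, ← tsum_mul_left]
    refine tsum_congr fun i => ?_
    have hx' : (x : ℂ) ≠ 0 := by exact_mod_cast hx.ne'
    have hy' : (y : ℂ) ≠ 0 := by exact_mod_cast hy.ne'
    rw [Real.log_div hx.ne' hy.ne', cpow_def_of_ne_zero hx', cpow_sub _ _ hy', cpow_one,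
      cpow_def_of_ne_zero hy', ← Complex.ofReal_log hx.le, ← Complex.ofReal_log hy.le]
    push_cast
    rw [mul_sub (i.1 : ℂ) (Real.log x : ℂ), Complex.exp_sub, mul_comm (i.1 : ℂ) (Real.log x : ℂ),
      mul_comm (i.1 : ℂ) (Real.log y : ℂ)]
    ring
  have hprime : ∀ n, primeTerm n (Real.log (x / y)) = 0 :=
    primeTerm_eq_zero (by rw [hexp, div_lt_iff₀ hy]; exact hxy2)
  have h3 := tsum_trivialTerm hy hxy
  have hy' : (y : ℂ) ≠ 0 := by exact_mod_cast hy.ne'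
  rw [h2, h1, explicitSide, ← Complex.ofReal_tsum]
  simp only [hprime, Complex.ofReal_zero, tsum_zero, add_zero, one_mul]
  rw [← Complex.ofReal_exp, hexp, mul_sub, ← Complex.ofReal_mul y, h3, kernelMain,
    Real.log_div hx.ne' hy.ne']
  push_cast
  field_simp
  ring

/-! ### The covariances as mixed second differences -/

lemma covTerm_eq (hRH : RiemannHypothesis) {r : ℕ} {δ : ℝ} {t : Fin r → ℝ} {j k : Fin r}
    (hk : 0 < 1 + (t k - 1 / 2) * δ) (hk' : 0 < 1 + (t k + 1 / 2) * δ) (i : ZeroIndex) :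
    covTerm δ t j k i = 1 / ((i.1 : ℂ) * (1 - (i.1 : ℂ))) *
      ((((1 + (t j + 1 / 2) * δ : ℝ) : ℂ) ^ (i.1 : ℂ) - ((1 + (t j - 1 / 2) * δ : ℝ) : ℂ) ^ (i.1 : ℂ))
      * (((1 + (t k + 1 / 2) * δ : ℝ) : ℂ) ^ (1 - (i.1 : ℂ))
        - ((1 + (t k - 1 / 2) * δ : ℝ) : ℂ) ^ (1 - (i.1 : ℂ)))) := by
  have hconj : ∀ x : ℝ, 0 < x → (starRingEnd ℂ) ((x : ℂ) ^ (i.1 : ℂ)) = (x : ℂ) ^ (1 - (i.1 : ℂ)) :=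
    fun x hx => by
      rw [← conj_eq_one_sub hRH, Complex.cpow_conj, Complex.conj_ofReal]
      rw [Complex.arg_ofReal_of_nonneg hx.le]
      exact Real.pi_pos.ne
  rw [covTerm, w, w, map_mul, map_sub, hconj _ hk, hconj _ hk', map_div₀, map_one,
    conj_eq_one_sub hRH]
  have := i.ne_zero
  have := i.one_sub_ne_zero
  field_simp

theorem hasSum_covTerm (hRH : RiemannHypothesis) {r : ℕ} {δ : ℝ} {t : Fin r → ℝ} {j k : Fin r}
    (hj : 0 < 1 + (t j - 1 / 2) * δ) (hj' : 0 < 1 + (t j + 1 / 2) * δ)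
    (hk : 0 < 1 + (t k - 1 / 2) * δ) (hk' : 0 < 1 + (t k + 1 / 2) * δ) :
    HasSum (covTerm δ t j k)
      (zeroKernel (1 + (t j + 1 / 2) * δ) (1 + (t k + 1 / 2) * δ)
        - zeroKernel (1 + (t j + 1 / 2) * δ) (1 + (t k - 1 / 2) * δ)
        - zeroKernel (1 + (t j - 1 / 2) * δ) (1 + (t k + 1 / 2) * δ)
        + zeroKernel (1 + (t j - 1 / 2) * δ) (1 + (t k - 1 / 2) * δ)) := by
  have := (((summable_zeroKernel hRH hj' hk').hasSum.sub (summable_zeroKernel hRH hj' hk).hasSum).sub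
    (summable_zeroKernel hRH hj hk').hasSum).add (summable_zeroKernel hRH hj hk).hasSum
  refine this.congr_fun fun i => ?_
  rw [covTerm_eq hRH hk hk']
  ring

/-! ### Elementary estimates -/

lemma log_sub_log_le {a b : ℝ} (ha : 0 < a) (hb : 0 < b) :
    Real.log b - Real.log a ≤ (b - a) / a := by
  rw [← Real.log_div hb.ne' ha.ne']
  refine (Real.log_le_sub_one_of_pos (by positivity)).trans (le_of_eq ?_)
  field_simp

lemma le_log_sub_log {a b : ℝ} (ha : 0 < a) (hb : 0 < b) :
    (b - a) / b ≤ Real.log b - Real.log a := by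
  have := log_sub_log_le hb ha
  have h : (a - b) / b = -((b - a) / b) := by ring
  linarith

lemma second_difference_mul_log_mem {m δ : ℝ} (hδ : 0 < δ) (hm : δ < m) :
    0 ≤ (m + δ) * Real.log (m + δ) - 2 * (m * Real.log m) + (m - δ) * Real.log (m - δ) ∧
      (m + δ) * Real.log (m + δ) - 2 * (m * Real.log m) + (m - δ) * Real.log (m - δ)
        ≤ 2 * δ ^ 2 / m := by
  have hm0 : 0 < m := by linarith
  have h1 := le_log_sub_log hm0 (by linarith : 0 < m + δ)
  have h2 := le_log_sub_log hm0 (by linarith : 0 < m - δ)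
  have h3 := log_sub_log_le hm0 (by linarith : 0 < m + δ)
  have h4 := log_sub_log_le hm0 (by linarith : 0 < m - δ)
  rw [div_le_iff₀ (by linarith)] at h1 h2
  have h3' := mul_le_mul_of_nonneg_left h3 (by linarith : 0 ≤ m + δ)
  have h4' := mul_le_mul_of_nonneg_left h4 (by linarith : 0 ≤ m - δ)
  constructor
  · nlinarith
  · have e : (m + δ) * ((m + δ - m) / m) + (m - δ) * ((m - δ - m) / m) = 2 * δ ^ 2 / m := by
      field_simp; ring
    nlinarith

lemma mul_mul_log_mul {c δ : ℝ} (hδ : 0 < δ) :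
    c * δ * Real.log (c * δ) = δ * (c * Real.log c) + c * δ * Real.log δ := by
  rcases eq_or_ne c 0 with rfl | hc
  · simp
  · rw [Real.log_mul hc hδ.ne']; ring

lemma abs_kernelMain_mixed_difference_le {A C δ d : ℝ} (hδ : 0 < δ) (hA : 7 / 8 ≤ A)
    (hC : 7 / 8 ≤ C) (hAC : A - C = d * δ) :
    |kernelMain (A + δ) (C + δ) - kernelMain (A + δ) C - kernelMain A (C + δ) + kernelMain A C
      - -Delta d * δ| ≤ 4 * δ ^ 2 := by
  have e1 : A + δ - (C + δ) = d * δ := by linarith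
  have e2 : A + δ - C = (d + 1) * δ := by linarith
  have e3 : A - (C + δ) = (d - 1) * δ := by linarith
  have e4 : A + δ + (C + δ) = (A + C + δ) + δ := by ring
  have e5 : A + δ + C = A + C + δ := by ring
  have e6 : A + (C + δ) = A + C + δ := by ring
  have e7 : A + C = (A + C + δ) - δ := by ring
  have h1 := log_sub_log_le (by linarith : 0 < C) (by linarith : 0 < C + δ)
  have h2 := log_sub_log_le (by linarith : 0 < A) (by linarith : 0 < A + δ)
  have h3 := le_log_sub_log (by linarith : 0 < C) (by linarith : 0 < C + δ)
  have h4 := le_log_sub_log (by linarith : 0 < A) (by linarith : 0 < A + δ)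
  obtain ⟨h5, h6⟩ := second_difference_mul_log_mem (m := A + C + δ) hδ (by linarith)
  have b1 : (C + δ - C) / C ≤ 2 * δ := by rw [div_le_iff₀ (by linarith)]; nlinarith
  have b2 : (A + δ - A) / A ≤ 2 * δ := by rw [div_le_iff₀ (by linarith)]; nlinarith
  have b3 : 0 ≤ (C + δ - C) / (C + δ) := div_nonneg (by linarith) (by linarith)
  have b4 : 0 ≤ (A + δ - A) / (A + δ) := div_nonneg (by linarith) (by linarith)
  have b5 : 2 * δ ^ 2 / (A + C + δ) ≤ 2 * δ ^ 2 := div_le_self (by positivity) (by linarith)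
  have key : kernelMain (A + δ) (C + δ) - kernelMain (A + δ) C - kernelMain A (C + δ)
      + kernelMain A C - -Delta d * δ
      = δ * (Real.log (C + δ) - Real.log C) + δ * (Real.log (A + δ) - Real.log A)
        - 1 / 2 * ((A + C + δ + δ) * Real.log (A + C + δ + δ)
          - 2 * ((A + C + δ) * Real.log (A + C + δ))
          + (A + C + δ - δ) * Real.log (A + C + δ - δ)) := by
    simp only [kernelMain, Delta, halfMulLog]
    rw [e1, e2, e3, hAC, e4, e5, e6, mul_mul_log_mul hδ, mul_mul_log_mul hδ, mul_mul_log_mul hδ,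
      add_sub_cancel_right]
    ring
  rw [key, abs_le]
  have c1 : 0 ≤ δ * (Real.log (C + δ) - Real.log C) := mul_nonneg hδ.le (by linarith)
  have c2 : 0 ≤ δ * (Real.log (A + δ) - Real.log A) := mul_nonneg hδ.le (by linarith)
  have c3 : δ * (Real.log (C + δ) - Real.log C) ≤ δ * (2 * δ) := by gcongr; linarith
  have c4 : δ * (Real.log (A + δ) - Real.log A) ≤ δ * (2 * δ) := by gcongr; linarith
  constructor <;> nlinarith

lemma abs_kernelMain_second_difference_le {A δ τ : ℝ} (hδ : 0 < δ) (hA : 7 / 8 ≤ A)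
    (hτ1 : 1 ≤ τ) (hτ : |A + δ - 1| ≤ τ * δ) :
    |kernelMain (A + δ) (A + δ) - 2 * kernelMain (A + δ) A + kernelMain A A
      - (δ * Real.log (1 / δ)
        + (1 - Real.eulerMascheroniConstant - Real.log (2 * Real.pi)) * δ)|
      ≤ 7 * (τ * δ ^ 2) := by
  set B := A + δ with hB
  have hA0 : 0 < A := by linarith
  have hB0 : 0 < B := by linarith
  have hBA : B - A = δ := by rw [hB]; ring
  set m := (A + B) / 2 with hm
  have hm0 : 0 < m := by linarith
  have key : kernelMain B B - 2 * kernelMain B A + kernelMain A A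
      - (δ * Real.log (1 / δ) + (1 - Real.eulerMascheroniConstant - Real.log (2 * Real.pi)) * δ)
      = 2 * (B * (Real.log B - Real.log A)) - δ - 2 * (m * (Real.log B - Real.log m))
        + δ * Real.log B := by
    have l1 : Real.log (B + B) = Real.log 2 + Real.log B := by
      rw [← two_mul, Real.log_mul (by norm_num) hB0.ne']
    have l2 : Real.log (A + A) = Real.log 2 + Real.log A := by
      rw [← two_mul, Real.log_mul (by norm_num) hA0.ne']
    have l3 : Real.log (B + A) = Real.log 2 + Real.log m := by
      rw [← Real.log_mul (by norm_num) hm0.ne', hm]; ring_nf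
    have l4 : Real.log (1 / δ) = -Real.log δ := by rw [one_div, Real.log_inv]
    simp only [kernelMain, archConst]
    rw [l1, l2, l3, hBA, l4, Real.log_mul (by norm_num) Real.pi_ne_zero,
      sub_self, sub_self, hm, show δ = B - A from hBA.symm]
    ring
  have h1 := log_sub_log_le hA0 hB0
  have h2 := le_log_sub_log hA0 hB0
  have h3 := log_sub_log_le hm0 hB0
  have h4 := le_log_sub_log hm0 hB0
  have h5 := log_sub_log_le one_pos hB0
  have h6 := le_log_sub_log one_pos hB0
  rw [Real.log_one, sub_zero] at h5 h6
  rw [div_one] at h5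
  obtain ⟨t1, t2⟩ := abs_le.mp hτ
  have hδτ : δ ≤ τ * δ := by nlinarith
  have hδ2 : δ ^ 2 ≤ τ * δ ^ 2 := by nlinarith [sq_nonneg δ]
  have hb1 : -(2 * (τ * δ)) ≤ Real.log B := by
    refine le_trans ?_ h6
    rw [le_div_iff₀ hB0]
    nlinarith
  have hb2 : Real.log B ≤ 2 * (τ * δ) := by linarith
  have hBm : B - m = δ / 2 := by rw [hm]; linarith
  rw [hBA] at h1 h2
  rw [hBm] at h3 h4
  rw [le_div_iff₀ hA0] at h1
  rw [div_le_iff₀ hB0] at h2 h4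
  rw [le_div_iff₀ hm0] at h3
  have hba : Real.log B - Real.log A ≤ 2 * δ := by nlinarith
  have hbm : 0 ≤ Real.log B - Real.log m := by
    by_contra! h; nlinarith
  have hbm2 : Real.log B - Real.log m ≤ 2 * δ := by nlinarith
  have g1 : B * (Real.log B - Real.log A) ≤ δ + δ * (2 * δ) := by
    have : B * (Real.log B - Real.log A)
        = (Real.log B - Real.log A) * A + δ * (Real.log B - Real.log A) := by rw [← hBA]; ring
    rw [this]
    gcongr
  have g2 : δ / 2 - δ / 2 * (2 * δ) ≤ m * (Real.log B - Real.log m) := by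
    have e : m * (Real.log B - Real.log m)
        = (Real.log B - Real.log m) * B - δ / 2 * (Real.log B - Real.log m) := by rw [← hBm]; ring
    have e' : δ / 2 * (Real.log B - Real.log m) ≤ δ / 2 * (2 * δ) := by gcongr
    linarith
  have g3 : δ * Real.log B ≤ δ * (2 * (τ * δ)) := by gcongr
  have g4 : δ * -(2 * (τ * δ)) ≤ δ * Real.log B := by gcongr
  rw [key, abs_le]
  constructor <;> nlinarith

/-! ### The asymptotic formulas -/

lemma bounds_of_T_le {δ τ : ℝ} (hδ : 0 < δ) (hδ' : δ ≤ 1 / 64)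
    (hτ : τ ≤ δ ^ (-(1 / 2) : ℝ) * (Real.log (1 / δ))⁻¹) :
    1 ≤ Real.log (1 / δ) ∧ τ * δ ≤ 1 / 8 := by
  have hlog : 1 ≤ Real.log (1 / δ) := by
    rw [Real.le_log_iff_exp_le (by positivity)]
    have h1 : (64 : ℝ) ≤ 1 / δ := by rw [le_div_iff₀ hδ]; linarith
    linarith [Real.exp_one_lt_three]
  refine ⟨hlog, ?_⟩
  have h1 : τ ≤ δ ^ (-(1 / 2) : ℝ) :=
    hτ.trans (mul_le_of_le_one_right (by positivity) (inv_le_one_of_one_le₀ hlog))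
  have h2 : δ ^ (-(1 / 2) : ℝ) * δ = Real.sqrt δ := by
    rw [← Real.rpow_add_one hδ.ne', Real.sqrt_eq_rpow]; norm_num
  have h3 : Real.sqrt δ ≤ 1 / 8 := by
    rw [Real.sqrt_le_left (by norm_num)]; linarith
  calc τ * δ ≤ δ ^ (-(1 / 2) : ℝ) * δ := by gcongr
    _ ≤ 1 / 8 := by rw [h2]; exact h3

lemma abs_endpoint_sub_one_le {δ τ x s : ℝ} (hδ : 0 < δ) (hx : 1 + |x| ≤ τ) (hs : |s| ≤ 1 / 2) :
    |1 + (x + s) * δ - 1| ≤ τ * δ := by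
  rw [add_sub_cancel_left, abs_mul, abs_of_pos hδ]
  gcongr
  linarith [abs_add_le x s]

theorem norm_variance_sub_le (hRH : RiemannHypothesis) {r : ℕ} {δ : ℝ} {t : Fin r → ℝ} {j : Fin r}
    {τ : ℝ} (hδ : 0 < δ) (hτ : τ * δ ≤ 1 / 8) (hj : 1 + |t j| ≤ τ) :
    ‖V δ t j - ((δ * Real.log (1 / δ) +
      (1 - Real.eulerMascheroniConstant - Real.log (2 * Real.pi)) * δ : ℝ) : ℂ)‖
        ≤ 7 * (τ * δ ^ 2) := by
  have hA := abs_endpoint_sub_one_le (s := -(1 / 2)) hδ hj (by rw [abs_neg, abs_of_pos]; norm_num)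
  have hB := abs_endpoint_sub_one_le (s := 1 / 2) hδ hj (by rw [abs_of_pos]; norm_num)
  rw [← sub_eq_add_neg] at hA
  obtain ⟨A, hAe⟩ : ∃ A, A = 1 + (t j - 1 / 2) * δ := ⟨_, rfl⟩
  have hBe : 1 + (t j + 1 / 2) * δ = A + δ := by rw [hAe]; ring
  have hτ1 : 1 ≤ τ := by linarith [abs_nonneg (t j)]
  rw [← hAe] at hA
  rw [hBe] at hB
  obtain ⟨a1, a2⟩ := abs_le.mp hA
  obtain ⟨b1, b2⟩ := abs_le.mp hB
  have hsum := hasSum_covTerm hRH (δ := δ) (t := t) (j := j) (k := j) (by rw [← hAe]; linarith)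
    (by rw [hBe]; linarith) (by rw [← hAe]; linarith) (by rw [hBe]; linarith)
  rw [V, Cov, hsum.tsum_eq, ← hAe, hBe, zeroKernel_symm A (A + δ),
    zeroKernel_eq hRH (by linarith) le_rfl (by linarith),
    zeroKernel_eq hRH (by linarith) (by linarith : A ≤ A + δ) (by linarith),
    zeroKernel_eq hRH (by linarith : 0 < A) le_rfl (by linarith)]
  have := abs_kernelMain_second_difference_le hδ (by linarith : 7 / 8 ≤ A) hτ1 hB
  rw [← Real.norm_eq_abs, ← Complex.norm_real] at this
  convert this using 2
  push_cast
  ring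

lemma norm_mixed_difference_sub_le (hRH : RiemannHypothesis) {δ x y τ : ℝ} (hδ : 0 < δ)
    (hτ : τ * δ ≤ 1 / 8) (hx : 1 + |x| ≤ τ) (hy : 1 + |y| ≤ τ) (hxy : 1 ≤ x - y) :
    ‖zeroKernel (1 + (x + 1 / 2) * δ) (1 + (y + 1 / 2) * δ)
        - zeroKernel (1 + (x + 1 / 2) * δ) (1 + (y - 1 / 2) * δ)
        - zeroKernel (1 + (x - 1 / 2) * δ) (1 + (y + 1 / 2) * δ)
        + zeroKernel (1 + (x - 1 / 2) * δ) (1 + (y - 1 / 2) * δ)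
        - ((-Delta (x - y) * δ : ℝ) : ℂ)‖ ≤ 4 * δ ^ 2 := by
  have hA := abs_endpoint_sub_one_le (s := -(1 / 2)) hδ hx (by rw [abs_neg, abs_of_pos]; norm_num)
  have hB := abs_endpoint_sub_one_le (s := 1 / 2) hδ hx (by rw [abs_of_pos]; norm_num)
  have hC := abs_endpoint_sub_one_le (s := -(1 / 2)) hδ hy (by rw [abs_neg, abs_of_pos]; norm_num)
  have hD := abs_endpoint_sub_one_le (s := 1 / 2) hδ hy (by rw [abs_of_pos]; norm_num)
  rw [← sub_eq_add_neg] at hA hC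
  obtain ⟨A, hAe⟩ : ∃ A, A = 1 + (x - 1 / 2) * δ := ⟨_, rfl⟩
  obtain ⟨C, hCe⟩ : ∃ C, C = 1 + (y - 1 / 2) * δ := ⟨_, rfl⟩
  have hBe : 1 + (x + 1 / 2) * δ = A + δ := by rw [hAe]; ring
  have hDe : 1 + (y + 1 / 2) * δ = C + δ := by rw [hCe]; ring
  have hAC : A - C = (x - y) * δ := by rw [hAe, hCe]; ring
  have hδAC : δ ≤ A - C := by rw [hAC]; nlinarith
  rw [← hAe] at hA ⊢
  rw [← hCe] at hC ⊢
  rw [hBe] at hB ⊢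
  rw [hDe] at hD ⊢
  obtain ⟨a1, a2⟩ := abs_le.mp hA
  obtain ⟨b1, b2⟩ := abs_le.mp hB
  obtain ⟨c1, c2⟩ := abs_le.mp hC
  obtain ⟨d1, d2⟩ := abs_le.mp hD
  rw [zeroKernel_eq hRH (by linarith : 0 < C + δ) (by linarith : C + δ ≤ A + δ) (by linarith),
    zeroKernel_eq hRH (by linarith : 0 < C) (by linarith : C ≤ A + δ) (by linarith),
    zeroKernel_eq hRH (by linarith : 0 < C + δ) (by linarith : C + δ ≤ A) (by linarith),
    zeroKernel_eq hRH (by linarith : 0 < C) (by linarith : C ≤ A) (by linarith)]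
  have := abs_kernelMain_mixed_difference_le hδ (by linarith : 7 / 8 ≤ A) (by linarith : 7 / 8 ≤ C) hAC
  rw [← Real.norm_eq_abs, ← Complex.norm_real] at this
  convert this using 2
  push_cast
  ring

lemma endpoints_pos {δ x τ : ℝ} (hδ : 0 < δ) (hτ : τ * δ ≤ 1 / 8) (hx : 1 + |x| ≤ τ) :
    0 < 1 + (x - 1 / 2) * δ ∧ 0 < 1 + (x + 1 / 2) * δ := by
  have hA := abs_endpoint_sub_one_le (s := -(1 / 2)) hδ hx (by rw [abs_neg, abs_of_pos]; norm_num)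
  have hB := abs_endpoint_sub_one_le (s := 1 / 2) hδ hx (by rw [abs_of_pos]; norm_num)
  rw [← sub_eq_add_neg] at hA
  have a1 := (abs_le.mp hA).1
  have b1 := (abs_le.mp hB).1
  constructor <;> linarith

theorem norm_covariance_sub_le (hRH : RiemannHypothesis) {r : ℕ} {δ : ℝ} {t : Fin r → ℝ}
    {j k : Fin r} {τ : ℝ} (hδ : 0 < δ) (hτ : τ * δ ≤ 1 / 8) (hj : 1 + |t j| ≤ τ)
    (hk : 1 + |t k| ≤ τ) (hjk : 1 ≤ |t j - t k|) :
    ‖Cov δ t j k - ((-Delta |t j - t k| * δ : ℝ) : ℂ)‖ ≤ 4 * δ ^ 2 := by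
  obtain ⟨hj1, hj2⟩ := endpoints_pos hδ hτ hj
  obtain ⟨hk1, hk2⟩ := endpoints_pos hδ hτ hk
  rw [Cov, (hasSum_covTerm hRH hj1 hj2 hk1 hk2).tsum_eq]
  rcases le_total 0 (t j - t k) with h | h
  · rw [abs_of_nonneg h] at hjk ⊢
    exact norm_mixed_difference_sub_le hRH hδ hτ hj hk hjk
  · rw [abs_of_nonpos h, neg_sub] at hjk ⊢
    have := norm_mixed_difference_sub_le hRH hδ hτ hk hj hjk
    simp only [zeroKernel_symm (1 + (t j + 1 / 2) * δ), zeroKernel_symm (1 + (t j - 1 / 2) * δ)]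
    rwa [sub_right_comm (zeroKernel (1 + (t k + 1 / 2) * δ) (1 + (t j + 1 / 2) * δ))]

end PrimesInShortIntervals

theorem mainTheorem5 (hRH : RiemannHypothesis)
    (hLI : PrimesInShortIntervals.LinearIndependenceConjecture) :
    ∃ C > (0 : ℝ), ∃ δ₀ > (0 : ℝ), ∀ δ : ℝ, 0 < δ → δ ≤ δ₀ →
      ∀ (r : ℕ) (t : Fin r → ℝ), (∀ j k : Fin r, j ≠ k → 1 ≤ |t j - t k|) →
      ∀ j k : Fin r,
        PrimesInShortIntervals.T t j k ≤ δ ^ (-(1 / 2) : ℝ) * (Real.log (1 / δ))⁻¹ →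
        Summable (PrimesInShortIntervals.covTerm δ t j k) ∧
        (j = k →
          ‖PrimesInShortIntervals.V δ t j -
              ((δ * Real.log (1 / δ) +
                (1 - Real.eulerMascheroniConstant - Real.log (2 * Real.pi)) * δ : ℝ) : ℂ)‖
            ≤ C * (PrimesInShortIntervals.T t j k * δ * Real.log (1 / δ)) ^ 2) ∧
        (j ≠ k →
          ‖PrimesInShortIntervals.Cov δ t j k -
              ((-PrimesInShortIntervals.Delta |t j - t k| * δ : ℝ) : ℂ)‖
            ≤ C * (PrimesInShortIntervals.T t j k * δ * Real.log (1 / δ)) ^ 2) := by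
  open PrimesInShortIntervals in
  refine ⟨7, by norm_num, 1 / 64, by norm_num, fun δ hδ hδ' r t ht j k hT => ?_⟩
  obtain ⟨hlog, hτ⟩ := bounds_of_T_le hδ hδ' hT
  have hj : 1 + |t j| ≤ T t j k := by rw [T]; gcongr; exact le_max_left _ _
  have hk : 1 + |t k| ≤ T t j k := by rw [T]; gcongr; exact le_max_right _ _
  have hT1 : 1 ≤ T t j k := by linarith [abs_nonneg (t j)]
  obtain ⟨hj1, hj2⟩ := endpoints_pos hδ hτ hj
  obtain ⟨hk1, hk2⟩ := endpoints_pos hδ hτ hk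
  have hbound : T t j k * δ ^ 2 ≤ (T t j k * δ * Real.log (1 / δ)) ^ 2 := by
    have h1 : T t j k ≤ T t j k ^ 2 := by nlinarith
    calc T t j k * δ ^ 2 ≤ T t j k ^ 2 * δ ^ 2 * 1 ^ 2 := by rw [one_pow, mul_one]; gcongr
      _ ≤ T t j k ^ 2 * δ ^ 2 * Real.log (1 / δ) ^ 2 := by gcongr
      _ = _ := by ring
  refine ⟨(hasSum_covTerm hRH hj1 hj2 hk1 hk2).summable, fun _ => ?_, fun hjk => ?_⟩
  · exact (norm_variance_sub_le hRH hδ hτ hj).trans (by gcongr)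
  · refine (norm_covariance_sub_le hRH hδ hτ hj hk (ht j k hjk)).trans ?_
    have h2 : δ ^ 2 ≤ T t j k * δ ^ 2 := le_mul_of_one_le_left (by positivity) hT1
    linarith [sq_nonneg δ]
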